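/- Let $\tau=\{\tau_0,\tau_1,\dots\}$ and $\sigma=\{\sigma_0,\sigma_1,\dots\}$ be two independent discrete renewal processes with $\tau_0=\sigma_0=0$, that is, each has i.i.d. inter-arrival times with values in $\{1,2,\dots\}\cup\{\infty\}$; here $\tau$ and $\sigma$ are also regarded as the random sets of their finite renewal times. Assume that there are real numbers $\alpha,\tilde\alpha\ge 0$ and functions $\varphi,\tilde\varphi$, slowly varying at infinity (measurable, positive near infinity, with $\varphi(cx)/\varphi(x)\to1$ as $x\to\infty$ for every $c>0$, and likewise for $\tilde\varphi$), such that for every integer $n\ge1$ $$\mathbf P(\tau_1=n)=\varphi(n)\,n^{-(1+\alpha)},\qquad \mathbf P(\sigma_1=n)=\tilde\varphi(n)\,n^{-(1+\tilde\alpha)}.$$ Let $\rho=\tau\cap\sigma$, let $\rho_1=\inf\{n\ge1: n\in\rho\}\in\{1,2,\dots\}\cup\{\infty\}$ be its first positive point, and let $|\rho|$ be its number of points (the point $0$ included). If $\rho$ is transient, that is, if $\mathbf P(\rho_1=\infty)>0$, then $\mathbf E(|\rho|)<\infty$ and $$\mathbf P(\rho_1=n)\;\sim\;\frac{1}{\mathbf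 E(|\rho|)^{2}}\,\mathbf P(n\in\tau)\,\mathbf P(n\in\sigma)\qquad\text{as } n\to\infty .$$ -/

import Mathlib

open MeasureTheory ProbabilityTheory Filter Topology Asymptotics
open scoped ENNReal

/-- `φ` is slowly varying at infinity: measurable, positive near infinity, and
`φ (c x) / φ x → 1` as `x → ∞` for every fixed `c > 0`. -/
def SlowlyVarying (φ : ℝ → ℝ) : Prop :=
  Measurable φ ∧ (∀ᶠ x in atTop, 0 < φ x) ∧
    ∀ c : ℝ, 0 < c → Tendsto (fun x : ℝ => φ (c * x) / φ x) atTop (𝓝 1)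

section Renewal

variable {Ω : Type*}

/-- The inter-arrival times `ξ 0, ξ 1, …` of a non-delayed discrete renewal process: i.i.d. random
variables with values in `{1, 2, …} ∪ {∞}`. -/
structure IsInterarrival [MeasurableSpace Ω] (ξ : ℕ → Ω → ℕ∞) (P : Measure Ω) : Prop where
  measurable : ∀ i, Measurable (ξ i)
  pos : ∀ i, ∀ᵐ ω ∂P, 1 ≤ ξ i ω
  indep : iIndepFun ξ P
  identDistrib : ∀ i, IdentDistrib (ξ i) (ξ 0) P P

/-- The `k`-th renewal time `τ_k = ξ 0 + ⋯ + ξ (k - 1)`, possibly infinite; `τ_0 = 0`. -/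
def renewalTime (ξ : ℕ → Ω → ℕ∞) (k : ℕ) (ω : Ω) : ℕ∞ :=
  ∑ i ∈ Finset.range k, ξ i ω

/-- The random set of the finite renewal times. -/
def renewalSet (ξ : ℕ → Ω → ℕ∞) (ω : Ω) : Set ℕ :=
  {n | ∃ k : ℕ, renewalTime ξ k ω = (n : ℕ∞)}

/-- The first positive point of a random set of natural numbers, `∞` if there is none. -/
noncomputable def firstPoint (A : Ω → Set ℕ) (ω : Ω) : ℕ∞ :=
  ⨅ n ∈ {n : ℕ | n ∈ A ω ∧ 0 < n}, (n : ℕ∞)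

/-- A renewal process, seen as a random set, is transient if with positive probability its first
positive point is infinite. -/
def Transient [MeasurableSpace Ω] (A : Ω → Set ℕ) (P : Measure Ω) : Prop :=
  0 < P {ω | firstPoint A ω = ⊤}

/-- The expected number of points of a random set of natural numbers. -/
noncomputable def expectedCard [MeasurableSpace Ω] (A : Ω → Set ℕ) (P : Measure Ω) : ℝ≥0∞ :=
  ∫⁻ ω, ((A ω).encard : ℝ≥0∞) ∂P

end Renewal

/-!
For a renewal process with first step law `p` let `a n` be the probability of a renewal at `n`. The
intersection of the two renewal sets is again a renewal set (`renewalPair_inter`), with mass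
function `u n = a n * b n` by independence, and with `∑ u` finite when it is transient.

If `u` is summable, `u (n + 1) / u n → 1`, and `u` is *doubling*, that is, bounded on `[n / 4, n]`
by a multiple of `u n`, then the first return law `f` satisfies `f n ~ u n / (∑ u) ^ 2`
(`RenewalPair.tendsto_law_div_mass`): splitting the renewal equation at `n / 2` and using dominated
convergence, `g = f / u` satisfies `u * g → 1 / ∑ u`, and convolution with `1 - f`, the inverse of
`u`, recovers `g`. Both properties are stable under products, so it is enough to prove them for the
mass function `a` of a single process whose step law is regularly varying
(`RenewalPair.doublingSeq_and_tendsto_ratio`).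

With `r` the tail of `p`, the renewal equation in the forms
`(n + 1) a (n + 1) = ∑ (k + 1) p (k + 1) (a * a) (n - k)` and
`∑_{k ≤ n} a k = ∑ r k (a * a) (n - k)` gives the doubling property in three cases.

* Finite mean: `a` has a positive limit, by the renewal theorem of Erdős, Feller and Pollard.
* Recurrent with infinite mean and index `α > 0`: by Karamata's theorem `(k + 1) p (k + 1)` is
  asymptotic to `α r k`, and `a → 0` makes finitely many `k` negligible, so that the two identities
  yield `n a n ~ α ∑_{k < n} a k` (`RenewalPair.doublingSeq_of_recurrent`).
* Transient, or `α = 0`: the mean of `p` truncated at a small fraction of `n` is small compared to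
  `∑_{k ≤ n} r k`, which is of order `n / ∑_{k ≤ n} a k`. The first identity then bounds `a n` by a
  constant times `p n (∑_{k ≤ n} a k) ^ 2` plus a small multiple of earlier values, a contraction;
  one big jump gives the matching lower bound
  (`RenewalPair.doublingSeq_of_smallTruncatedMean`).

When the mean is infinite, the ratios of `a` tend to `1` because the increments of `n a n` are
convolutions with the increments of `n p n`, which are `o (n p n)`
(`RenewalPair.tendsto_ratio_of_doublingSeq`).
All facts on slow variation are drawn from Potter's bounds, which follow from the uniform
convergence theorem.
-/

/-! ### Slowly varying functions -/

/-- If `h (x + s) - h x → 0` for every `s`, then along any sequence `x n → ∞` this difference is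
small uniformly on a subset of `[0, 2]` of measure more than `3 / 2`. -/
theorem eventually_lt_volume_forall_abs_sub_le {h : ℝ → ℝ}
    (hh : ∀ s, Tendsto (fun x => h (x + s) - h x) atTop (𝓝 0)) {x : ℕ → ℝ}
    (hx : Tendsto x atTop atTop) {ε : ℝ} (hε : 0 < ε) :
    ∀ᶠ n in atTop, ENNReal.ofReal (3 / 2) <
      volume {s ∈ Set.Icc (0 : ℝ) 2 | ∀ m ≥ n, |h (x m + s) - h (x m)| ≤ ε} := by
  have hmono : Monotone fun n : ℕ =>
      {s ∈ Set.Icc (0 : ℝ) 2 | ∀ m ≥ n, |h (x m + s) - h (x m)| ≤ ε} :=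
    fun i j hij s hs => ⟨hs.1, fun m hmj => hs.2 m (hij.trans hmj)⟩
  have hlim := tendsto_measure_iUnion_atTop (μ := volume) hmono
  have hU : (⋃ n : ℕ, {s ∈ Set.Icc (0 : ℝ) 2 | ∀ m ≥ n, |h (x m + s) - h (x m)| ≤ ε}) =
      Set.Icc 0 2 := by
    ext s
    simp only [Set.mem_iUnion, Set.mem_ofPred_eq]
    refine ⟨fun ⟨n, hn⟩ => hn.1, fun hs => ?_⟩
    have := ((hh s).comp hx).abs.eventually (eventually_le_nhds (b := ε) (by simpa using hε))
    obtain ⟨n, hn⟩ := eventually_atTop.1 this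
    exact ⟨n, hs, hn⟩
  rw [hU, Real.volume_Icc] at hlim
  exact hlim.eventually (lt_mem_nhds (by rw [ENNReal.ofReal_lt_ofReal_iff] <;> norm_num))

/-- The uniform convergence theorem, in additive form. The set of shifts that are good from `x n`
and the set of shifts that are good from `x n + t n`, translated by `t n`, have measure more than
`3 / 2` in `[0, 3]`, so that they meet. -/
theorem uniform_convergence_of_tendsto_sub {h : ℝ → ℝ} (hm : Measurable h)
    (hh : ∀ s, Tendsto (fun x => h (x + s) - h x) atTop (𝓝 0)) {ε : ℝ} (hε : 0 < ε) :
    ∃ X : ℝ, ∀ x ≥ X, ∀ t ∈ Set.Icc (0 : ℝ) 1, |h (x + t) - h x| ≤ ε := by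
  by_contra! hcon
  choose x hx t ht hxt using fun n : ℕ => hcon n
  have hx1 : Tendsto x atTop atTop := tendsto_atTop_mono hx tendsto_natCast_atTop_atTop
  have hx2 : Tendsto (fun n => x n + t n) atTop atTop :=
    tendsto_atTop_mono (fun n => by linarith [(ht n).1]) hx1
  obtain ⟨n, hV, hW⟩ := ((eventually_lt_volume_forall_abs_sub_le hh hx1 (half_pos hε)).and
    (eventually_lt_volume_forall_abs_sub_le hh hx2 (half_pos hε))).exists
  set V := {s ∈ Set.Icc (0 : ℝ) 2 | ∀ m ≥ n, |h (x m + s) - h (x m)| ≤ ε / 2}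
  set W := {s ∈ Set.Icc (0 : ℝ) 2 | ∀ m ≥ n, |h (x m + t m + s) - h (x m + t m)| ≤ ε / 2}
  have hWm : MeasurableSet W := by
    have : W = Set.Icc (0 : ℝ) 2 ∩
        ⋂ m, ⋂ (_ : m ≥ n), {s | |h (x m + t m + s) - h (x m + t m)| ≤ ε / 2} := by
      ext s; simp [W]
    rw [this]
    refine measurableSet_Icc.inter (MeasurableSet.iInter fun m => MeasurableSet.iInter fun _ => ?_)
    exact measurableSet_le (by fun_prop) measurable_const
  have hdisj : Disjoint V ((fun s => s + -t n) ⁻¹' W) := by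
    rw [Set.disjoint_left]
    intro s hs hs'
    have h1 := hs.2 n le_rfl
    have h2 := hs'.2 n le_rfl
    rw [show x n + t n + (s + -t n) = x n + s by ring] at h2
    have := hxt n
    have h3 := abs_sub_le (h (x n + t n)) (h (x n + s)) (h (x n))
    rw [abs_sub_comm (h (x n + t n)) (h (x n + s))] at h3
    linarith
  have hsub : V ∪ ((fun s => s + -t n) ⁻¹' W) ⊆ Set.Icc 0 3 := by
    rintro s (hs | hs)
    · exact ⟨hs.1.1, hs.1.2.trans (by norm_num)⟩
    · have h1 := hs.1
      have h2 := ht n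
      simp only [Set.mem_Icc] at h1 h2 ⊢
      constructor <;> linarith
  have hle := measure_mono (μ := volume) hsub
  rw [measure_union hdisj (hWm.preimage (by fun_prop)), measure_preimage_add_right,
    Real.volume_Icc] at hle
  have hlt := ENNReal.add_lt_add hV hW
  rw [← ENNReal.ofReal_add (by norm_num) (by norm_num)] at hlt
  norm_num at hlt hle
  exact absurd (hlt.trans_le hle) (lt_irrefl _)

/-- The uniform convergence theorem for slowly varying functions, on `[1, exp 1]`. -/
theorem SlowlyVarying.exists_forall_le {φ : ℝ → ℝ} (hφ : SlowlyVarying φ) {ε : ℝ} (hε : 0 < ε) :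
    ∃ X : ℝ, 0 < X ∧ ∀ x y, X ≤ x → x ≤ y → y ≤ Real.exp 1 * x →
      0 < φ x ∧ φ y ≤ Real.exp ε * φ x ∧ φ x ≤ Real.exp ε * φ y := by
  obtain ⟨hm, hpos, hlim⟩ := hφ
  have hh : ∀ s, Tendsto (fun x => Real.log (φ (Real.exp (x + s))) - Real.log (φ (Real.exp x)))
      atTop (𝓝 0) := by
    intro s
    have h1 := (hlim (Real.exp s) (Real.exp_pos s)).comp Real.tendsto_exp_atTop
    have h2 := (Real.continuousAt_log one_ne_zero).tendsto.comp h1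
    rw [Real.log_one] at h2
    refine h2.congr' ?_
    have e1 : Tendsto (fun x : ℝ => Real.exp (x + s)) atTop atTop :=
      Real.tendsto_exp_atTop.comp (tendsto_atTop_add_const_right _ _ tendsto_id)
    filter_upwards [Real.tendsto_exp_atTop.eventually hpos, e1.eventually hpos] with x hx hx'
    simp only [Function.comp]
    rw [← Real.exp_add, add_comm s x, Real.log_div hx'.ne' hx.ne']
  obtain ⟨X, hX⟩ := uniform_convergence_of_tendsto_sub
    (h := fun x => Real.log (φ (Real.exp x)))
    (Real.measurable_log.comp (hm.comp Real.measurable_exp)) hh hε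
  obtain ⟨X', hX'⟩ := eventually_atTop.1 hpos
  refine ⟨max (Real.exp X) X', lt_max_of_lt_left (Real.exp_pos X), fun x y hx hxy hy => ?_⟩
  have hx0 : 0 < x := (Real.exp_pos X).trans_le ((le_max_left _ _).trans hx)
  have hy0 : 0 < y := hx0.trans_le hxy
  have px : 0 < φ x := hX' x ((le_max_right _ _).trans hx)
  have py : 0 < φ y := hX' y (((le_max_right _ _).trans hx).trans hxy)
  have key := hX (Real.log x) ((Real.le_log_iff_exp_le hx0).2 ((le_max_left _ _).trans hx))
    (Real.log y - Real.log x) ⟨sub_nonneg.2 (Real.log_le_log hx0 hxy), by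
      have := Real.log_le_log hy0 hy
      rw [Real.log_mul (Real.exp_ne_zero _) hx0.ne', Real.log_exp] at this
      linarith⟩
  simp only [add_sub_cancel, Real.exp_log hx0, Real.exp_log hy0] at key
  rw [abs_le] at key
  refine ⟨px, ?_, ?_⟩
  · rw [← Real.log_le_log_iff py (by positivity), Real.log_mul (Real.exp_ne_zero _) px.ne',
      Real.log_exp]
    linarith
  · rw [← Real.log_le_log_iff px (by positivity), Real.log_mul (Real.exp_ne_zero _) py.ne',
      Real.log_exp]
    linarith

/-- Potter's bounds, by iterating the uniform convergence theorem over the factors `exp 1` that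
lead from `x` to `y`. -/
theorem SlowlyVarying.potter {φ : ℝ → ℝ} (hφ : SlowlyVarying φ) {ε : ℝ} (hε : 0 < ε) :
    ∃ X : ℝ, 0 < X ∧ ∀ x y, X ≤ x → x ≤ y →
      0 < φ x ∧ φ y ≤ Real.exp ε * (y / x) ^ ε * φ x ∧ φ x ≤ Real.exp ε * (y / x) ^ ε * φ y := by
  obtain ⟨X, hX0, hX⟩ := hφ.exists_forall_le hε
  have iter : ∀ k : ℕ, ∀ x y, X ≤ x → Real.exp k * x ≤ y → y ≤ Real.exp (k + 1) * x →
      φ y ≤ Real.exp (ε * (k + 1)) * φ x ∧ φ x ≤ Real.exp (ε * (k + 1)) * φ y := by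
    intro k
    induction k with
    | zero =>
      intro x y hx hxy hy
      have := hX x y hx (by simpa using hxy) (by simpa using hy)
      simpa using this.2
    | succ k ih =>
      intro x y hx hxy hy
      have hx0 : 0 < x := hX0.trans_le hx
      have hxz : x ≤ Real.exp 1 * x := le_mul_of_one_le_left hx0.le (Real.one_le_exp zero_le_one)
      obtain ⟨-, h1, h2⟩ := hX x (Real.exp 1 * x) hx hxz le_rfl
      push_cast at hxy hy ⊢
      rw [Real.exp_add, mul_assoc] at hxy
      rw [Real.exp_add, mul_assoc] at hy
      obtain ⟨h3, h4⟩ := ih (Real.exp 1 * x) y (hx.trans hxz) hxy hy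
      have e : Real.exp (ε * (k + 1 + 1)) = Real.exp (ε * (k + 1)) * Real.exp ε := by
        rw [← Real.exp_add]; ring_nf
      constructor
      · calc φ y ≤ Real.exp (ε * (k + 1)) * φ (Real.exp 1 * x) := h3
          _ ≤ Real.exp (ε * (k + 1)) * (Real.exp ε * φ x) := by gcongr
          _ = _ := by rw [e, mul_assoc]
      · calc φ x ≤ Real.exp ε * φ (Real.exp 1 * x) := h2
          _ ≤ Real.exp ε * (Real.exp (ε * (k + 1)) * φ y) := by gcongr
          _ = _ := by rw [e]; ring
  refine ⟨X, hX0, fun x y hx hxy => ?_⟩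
  have hx0 : 0 < x := hX0.trans_le hx
  have hy0 : 0 < y := hx0.trans_le hxy
  have px := (hX x x hx le_rfl (le_mul_of_one_le_left hx0.le (Real.one_le_exp zero_le_one))).1
  have py := (hX y y (hx.trans hxy) le_rfl
    (le_mul_of_one_le_left hy0.le (Real.one_le_exp zero_le_one))).1
  have hl : 0 ≤ Real.log (y / x) := Real.log_nonneg ((one_le_div hx0).2 hxy)
  set k := ⌊Real.log (y / x)⌋₊
  have hk1 : (k : ℝ) ≤ Real.log (y / x) := Nat.floor_le hl
  have hk2 : Real.log (y / x) ≤ k + 1 := (Nat.lt_floor_add_one _).le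
  have hyx : Real.exp (Real.log (y / x)) * x = y := by
    rw [Real.exp_log (div_pos hy0 hx0)]; field_simp
  obtain ⟨h1, h2⟩ := iter k x y hx
    (by calc Real.exp k * x ≤ Real.exp (Real.log (y / x)) * x := by gcongr
          _ = y := hyx)
    (by calc y = Real.exp (Real.log (y / x)) * x := hyx.symm
          _ ≤ _ := by gcongr)
  have hle : Real.exp (ε * (k + 1)) ≤ Real.exp ε * (y / x) ^ ε := by
    rw [Real.rpow_def_of_pos (div_pos hy0 hx0), ← Real.exp_add]
    apply Real.exp_le_exp.2
    nlinarith
  exact ⟨px, h1.trans (by gcongr), h2.trans (by gcongr)⟩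

/-- The sequence `p` is positive near infinity and regularly varying of index `-β`, in the form of
Potter's bounds on ratios. -/
def RegVarSeq (β : ℝ) (p : ℕ → ℝ) : Prop :=
  ∀ ε : ℝ, 0 < ε → ∃ N : ℕ, 1 ≤ N ∧ ∀ m n : ℕ, N ≤ m → m ≤ n →
    0 < p m ∧ p n ≤ Real.exp ε * ((n : ℝ) / m) ^ (ε - β) * p m ∧
      p m ≤ Real.exp ε * ((n : ℝ) / m) ^ (ε + β) * p n

theorem SlowlyVarying.regVarSeq {φ : ℝ → ℝ} (hφ : SlowlyVarying φ) {β : ℝ} {p : ℕ → ℝ}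
    (hp : ∀ n : ℕ, 1 ≤ n → p n = φ n * (n : ℝ) ^ (-β)) : RegVarSeq β p := by
  intro ε hε
  obtain ⟨X, -, hX⟩ := hφ.potter hε
  refine ⟨max 1 ⌈X⌉₊, le_max_left _ _, fun m n hm hmn => ?_⟩
  have hm1 : 1 ≤ m := (le_max_left _ _).trans hm
  have hm0 : (0 : ℝ) < m := by exact_mod_cast hm1
  have hn0 : (0 : ℝ) < n := by exact_mod_cast hm1.trans hmn
  obtain ⟨h1, h2, h3⟩ := hX m n
    ((Nat.le_ceil X).trans (by exact_mod_cast (le_max_right _ _).trans hm)) (by exact_mod_cast hmn)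
  have e1 : ((n : ℝ) / m) ^ β = (n : ℝ) ^ β / (m : ℝ) ^ β := Real.div_rpow hn0.le hm0.le _
  have hnm : (0 : ℝ) < n / m := div_pos hn0 hm0
  have hnβ := Real.rpow_pos_of_pos hn0 β
  have hmβ := Real.rpow_pos_of_pos hm0 β
  rw [hp m hm1, hp n (hm1.trans hmn), Real.rpow_neg hn0.le, Real.rpow_neg hm0.le,
    Real.rpow_sub hnm, Real.rpow_add hnm, e1]
  refine ⟨by positivity, ?_, ?_⟩
  · calc φ n * ((n : ℝ) ^ β)⁻¹ ≤ (Real.exp ε * ((n : ℝ) / m) ^ ε * φ m) * ((n : ℝ) ^ β)⁻¹ := by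
          gcongr
      _ = _ := by field_simp
  · calc φ m * ((m : ℝ) ^ β)⁻¹ ≤ (Real.exp ε * ((n : ℝ) / m) ^ ε * φ n) * ((m : ℝ) ^ β)⁻¹ := by
          gcongr
      _ = _ := by field_simp

/-! ### Convolutions and partial sums of sequences -/

/-- The convolution (Cauchy product) of two sequences. -/
def conv (x y : ℕ → ℝ) (n : ℕ) : ℝ := ∑ ij ∈ Finset.HasAntidiagonal.antidiagonal n, x ij.1 * y ij.2

/-- The partial sums of a sequence, the last index included. -/
def psum (x : ℕ → ℝ) (n : ℕ) : ℝ := ∑ k ∈ Finset.range (n + 1), x k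

theorem conv_eq_sum_range (x y : ℕ → ℝ) (n : ℕ) :
    conv x y n = ∑ k ∈ Finset.range (n + 1), x k * y (n - k) :=
  Finset.Nat.sum_antidiagonal_eq_sum_range_succ (fun i j => x i * y j) n

theorem mk_conv (x y : ℕ → ℝ) :
    PowerSeries.mk (conv x y) = PowerSeries.mk x * PowerSeries.mk y := by
  ext n; simp [PowerSeries.coeff_mul, conv]

theorem eq_of_mk_eq {x y : ℕ → ℝ} (h : PowerSeries.mk x = PowerSeries.mk y) : x = y := by
  funext n; simpa using congrArg (PowerSeries.coeff n) h

theorem conv_comm (x y : ℕ → ℝ) : conv x y = conv y x :=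
  eq_of_mk_eq (by rw [mk_conv, mk_conv, mul_comm])

theorem conv_assoc (x y z : ℕ → ℝ) : conv (conv x y) z = conv x (conv y z) :=
  eq_of_mk_eq (by simp only [mk_conv, mul_assoc])

theorem psum_eq_conv (x : ℕ → ℝ) : psum x = conv x 1 := by
  funext n; simp [conv_eq_sum_range, psum]

theorem psum_conv (x y : ℕ → ℝ) : psum (conv x y) = conv x (psum y) := by
  simp only [psum_eq_conv, conv_assoc]

section Nonneg

variable {x y : ℕ → ℝ}

theorem conv_nonneg (hx : ∀ n, 0 ≤ x n) (hy : ∀ n, 0 ≤ y n) (n : ℕ) : 0 ≤ conv x y n :=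
  Finset.sum_nonneg fun _ _ => mul_nonneg (hx _) (hy _)

theorem psum_nonneg (hx : ∀ n, 0 ≤ x n) (n : ℕ) : 0 ≤ psum x n :=
  Finset.sum_nonneg fun _ _ => hx _

theorem psum_mono (hx : ∀ n, 0 ≤ x n) : Monotone (psum x) := fun _ _ h =>
  Finset.sum_le_sum_of_subset_of_nonneg (Finset.range_mono (by omega)) fun _ _ _ => hx _

theorem psum_conv_le (hx : ∀ n, 0 ≤ x n) (hy : ∀ n, 0 ≤ y n) (n : ℕ) :
    psum (conv x y) n ≤ psum x n * psum y n := by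
  rw [psum_conv, conv_eq_sum_range, psum, Finset.sum_mul]
  exact Finset.sum_le_sum fun k _ =>
    mul_le_mul_of_nonneg_left (psum_mono hy (Nat.sub_le n k)) (hx k)

theorem mul_le_psum_conv (hx : ∀ n, 0 ≤ x n) (hy : ∀ n, 0 ≤ y n) {n N : ℕ} (hN : 2 * n ≤ N) :
    psum x n * psum y n ≤ psum (conv x y) N := by
  rw [psum_conv, conv_eq_sum_range, psum, Finset.sum_mul]
  calc ∑ k ∈ Finset.range (n + 1), x k * psum y n
      ≤ ∑ k ∈ Finset.range (n + 1), x k * psum y (N - k) :=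
        Finset.sum_le_sum fun k hk => mul_le_mul_of_nonneg_left
          (psum_mono hy (by have := Finset.mem_range.1 hk; omega)) (hx k)
    _ ≤ _ := Finset.sum_le_sum_of_subset_of_nonneg (Finset.range_mono (by omega))
        fun k _ _ => mul_nonneg (hx k) (psum_nonneg hy _)

/-- One of the two indices of each term of `conv x x n` is at least `n / 2`. -/
theorem conv_self_le (hx : ∀ n, 0 ≤ x n) {n : ℕ} {M : ℝ}
    (hM : ∀ j, n ≤ 2 * j → j ≤ n → x j ≤ M) : conv x x n ≤ 2 * psum x n * M := by
  have hM0 : 0 ≤ M := (hx n).trans (hM n (by omega) le_rfl)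
  have h1 : ∑ k ∈ Finset.range (n + 1), x k * M = psum x n * M := by rw [psum, Finset.sum_mul]
  have h2 : ∑ k ∈ Finset.range (n + 1), x (n - k) * M = psum x n * M := by
    rw [← h1]
    have := Finset.sum_range_reflect (fun k => x k * M) (n + 1)
    rw [← this]
    exact Finset.sum_congr rfl fun k _ => by rw [Nat.add_sub_cancel]
  rw [mul_assoc, two_mul, conv_eq_sum_range]
  nth_rewrite 1 [← h1]
  rw [← h2, ← Finset.sum_add_distrib]
  refine Finset.sum_le_sum fun k hk => ?_
  have hk' := Finset.mem_range.1 hk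
  rcases le_total n (2 * k) with h | h
  · have := mul_le_mul_of_nonneg_right (hM k h (by omega)) (hx (n - k))
    have := mul_nonneg (hx k) hM0
    linarith
  · have := mul_le_mul_of_nonneg_left (hM (n - k) (by omega) (by omega)) (hx k)
    have := mul_nonneg (hx (n - k)) hM0
    linarith

end Nonneg

/-! ### The renewal equation -/

/-- The tail `1 - ∑_{k ≤ n} p k` of a subprobability. -/
def tail (p : ℕ → ℝ) (n : ℕ) : ℝ := 1 - psum p n

/-- `p` is a subprobability on the positive integers and `a` its renewal mass function: the formal
power series of `a` is the inverse of `1 - ∑ p n X ^ n`. -/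
structure RenewalPair (p a : ℕ → ℝ) : Prop where
  nonneg : ∀ n, 0 ≤ p n
  zero : p 0 = 0
  psum_le : ∀ n, psum p n ≤ 1
  mul_eq : PowerSeries.mk a * (1 - PowerSeries.mk p) = 1

namespace RenewalPair

variable {p a : ℕ → ℝ} (h : RenewalPair p a)
include h

theorem mass_zero : a 0 = 1 := by
  have := congrArg (PowerSeries.coeff 0) h.mul_eq
  simpa [PowerSeries.coeff_mul, h.zero] using this

theorem mass_eq {n : ℕ} (hn : 1 ≤ n) : a n = conv p a n := by
  have h1 := congrArg (PowerSeries.coeff n) h.mul_eq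
  rw [mul_sub, mul_one, mul_comm, ← mk_conv, map_sub, PowerSeries.coeff_one,
    if_neg (by omega)] at h1
  simp only [PowerSeries.coeff_mk] at h1
  linarith

theorem mass_mem (n : ℕ) : 0 ≤ a n ∧ a n ≤ 1 := by
  induction n using Nat.strong_induction_on with
  | _ n ih =>
    rcases Nat.eq_zero_or_pos n with rfl | hn
    · simp [h.mass_zero]
    · have hp0 : ∀ k ∈ Finset.range (n + 1), 0 ≤ p k * a (n - k) ∧ p k * a (n - k) ≤ p k := by
        intro k _
        rcases Nat.eq_zero_or_pos k with rfl | hk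
        · simp [h.zero]
        · obtain ⟨h0, h1⟩ := ih (n - k) (by omega)
          exact ⟨mul_nonneg (h.nonneg k) h0, mul_le_of_le_one_right (h.nonneg k) h1⟩
      rw [h.mass_eq hn, conv_eq_sum_range]
      exact ⟨Finset.sum_nonneg fun k hk => (hp0 k hk).1,
        (Finset.sum_le_sum fun k hk => (hp0 k hk).2).trans (h.psum_le n)⟩

theorem mass_nonneg (n : ℕ) : 0 ≤ a n := (h.mass_mem n).1

theorem mass_le_one (n : ℕ) : a n ≤ 1 := (h.mass_mem n).2

theorem conv_mass_nonneg (n : ℕ) : 0 ≤ conv a a n := conv_nonneg h.mass_nonneg h.mass_nonneg n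

theorem one_le_psum_mass (n : ℕ) : 1 ≤ psum a n := by
  have := psum_mono h.mass_nonneg (Nat.zero_le n)
  simpa [psum, h.mass_zero] using this

omit h in
theorem tail_succ (p : ℕ → ℝ) (n : ℕ) : tail p (n + 1) = tail p n - p (n + 1) := by
  simp [tail, psum, Finset.sum_range_succ _ (n + 1)]; ring

theorem tail_nonneg (n : ℕ) : 0 ≤ tail p n := sub_nonneg.2 (h.psum_le n)

theorem tail_antitone : Antitone (tail p) := fun _ _ hmn =>
  sub_le_sub_left (psum_mono h.nonneg hmn) 1

theorem tail_zero : tail p 0 = 1 := by simp [tail, psum, h.zero]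

theorem one_le_psum_tail (n : ℕ) : 1 ≤ psum (tail p) n := by
  have := psum_mono h.tail_nonneg (Nat.zero_le n)
  simpa [psum, h.tail_zero] using this

/-- The decomposition according to the last renewal up to `n`. -/
theorem conv_tail_mass : conv (tail p) a = 1 := by
  have h1 : PowerSeries.mk (tail p) * (1 - PowerSeries.X) = 1 - PowerSeries.mk p := by
    ext n
    rw [mul_sub, mul_one, map_sub, map_sub]
    cases n with
    | zero => simp [h.tail_zero, h.zero]
    | succ n =>
      rw [PowerSeries.coeff_succ_mul_X, PowerSeries.coeff_one, if_neg (by omega)]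
      simp only [PowerSeries.coeff_mk, tail_succ]
      ring
  have h2 : (PowerSeries.mk 1 : PowerSeries ℝ) * (1 - PowerSeries.X) = 1 :=
    PowerSeries.mk_one_mul_one_sub_eq_one ℝ
  have h3 : PowerSeries.mk (conv (tail p) a) * (1 - PowerSeries.X) = 1 := by
    rw [mk_conv, mul_right_comm, h1, mul_comm, h.mul_eq]
  apply eq_of_mk_eq
  calc PowerSeries.mk (conv (tail p) a)
      = PowerSeries.mk (conv (tail p) a) * (PowerSeries.mk 1 * (1 - PowerSeries.X)) := by
        rw [h2, mul_one]
    _ = PowerSeries.mk (conv (tail p) a) * (1 - PowerSeries.X) * PowerSeries.mk 1 := by ring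
    _ = PowerSeries.mk 1 := by rw [h3, one_mul]

theorem psum_mass_eq_conv (n : ℕ) : psum a n = conv (tail p) (conv a a) n := by
  rw [← conv_assoc, h.conv_tail_mass, psum_eq_conv, conv_comm]

/-- The renewal equation differentiated: `U = 1 / (1 - P)` gives `U' = P' U ^ 2`. -/
theorem succ_mul_mass_succ (n : ℕ) :
    ((n : ℝ) + 1) * a (n + 1) = conv (fun k => ((k : ℝ) + 1) * p (k + 1)) (conv a a) n := by
  have h1 := congrArg (PowerSeries.derivative ℝ) h.mul_eq
  rw [Derivation.leibniz, map_sub] at h1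
  simp only [Derivation.map_one_eq_zero, smul_eq_mul, zero_sub] at h1
  have hq : PowerSeries.mk (fun k => ((k : ℝ) + 1) * p (k + 1)) =
      PowerSeries.derivative ℝ (PowerSeries.mk p) := by
    ext n; simp [PowerSeries.coeff_derivative, mul_comm]
  have h2 : PowerSeries.derivative ℝ (PowerSeries.mk a) =
      PowerSeries.mk (conv (fun k => ((k : ℝ) + 1) * p (k + 1)) (conv a a)) := by
    rw [mk_conv, mk_conv, hq]
    linear_combination (PowerSeries.mk a) * h1 -
      (PowerSeries.derivative ℝ (PowerSeries.mk a)) * h.mul_eq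
  have h3 := congrArg (PowerSeries.coeff n) h2
  rw [PowerSeries.coeff_derivative] at h3
  simp only [PowerSeries.coeff_mk] at h3
  rw [← h3, mul_comm]

theorem le_psum_mass_mul (n : ℕ) : (n : ℝ) + 1 ≤ psum (tail p) n * psum a n := by
  have := psum_conv_le h.tail_nonneg h.mass_nonneg n
  rwa [h.conv_tail_mass, show psum 1 n = (n : ℝ) + 1 by simp [psum]] at this

/-- Together with `le_psum_mass_mul`: the sums up to `n` of `a` and of the tail have product of
order `n`, as the convolution of the two sequences is `1`. -/
theorem psum_mass_mul_le (n : ℕ) : psum (tail p) n * psum a n ≤ 2 * n + 1 := by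
  have := mul_le_psum_conv h.tail_nonneg h.mass_nonneg (le_refl (2 * n))
  rwa [h.conv_tail_mass, show psum 1 (2 * n) = 2 * (n : ℝ) + 1 by simp [psum]] at this

theorem psum_mass_le_of_le {m n : ℕ} (hmn : n ≤ 4 * m) : psum a n ≤ 8 * psum a m := by
  rcases le_total n m with h' | h'
  · linarith [psum_mono h.mass_nonneg h', h.one_le_psum_mass m]
  · have h1 := h.psum_mass_mul_le n
    have h2 := h.le_psum_mass_mul m
    have h3 : psum (tail p) m * psum a n ≤ psum (tail p) n * psum a n :=
      mul_le_mul_of_nonneg_right (psum_mono h.tail_nonneg h')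
        (zero_le_one.trans (h.one_le_psum_mass n))
    have h4 : (n : ℝ) ≤ 4 * m := by exact_mod_cast hmn
    have h5 := h.one_le_psum_tail m
    by_contra hlt
    push Not at hlt
    nlinarith

end RenewalPair

/-! ### The renewal theorem -/

namespace RenewalPair

variable {p a : ℕ → ℝ} (h : RenewalPair p a)
include h

omit h in
theorem conv_eq_tsum (x y : ℕ → ℝ) (n : ℕ) :
    conv x y n = ∑' k, x k * (if k ≤ n then y (n - k) else 0) := by
  rw [conv_eq_sum_range, tsum_eq_sum (s := Finset.range (n + 1))]
  · exact Finset.sum_congr rfl fun k hk => by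
      rw [if_pos (by have := Finset.mem_range.1 hk; omega)]
  · intro k hk
    rw [if_neg (by simpa using hk), mul_zero]

/-- Dominated convergence for a convolution with the mass function, along a filter. -/
theorem tendsto_conv_mass {x : ℕ → ℝ} (hx0 : ∀ n, 0 ≤ x n) (hx : Summable x)
    {U : Filter ℕ} {b : ℕ → ℝ} {g : ℕ → ℕ} (hg : Tendsto g U atTop)
    (hb : ∀ k, Tendsto (fun n => a (g n - k)) U (𝓝 (b k))) :
    Tendsto (fun n => conv x a (g n)) U (𝓝 (∑' k, x k * b k)) := by
  simp only [conv_eq_tsum]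
  refine tendsto_tsum_of_dominated_convergence hx (fun k => ?_) (Eventually.of_forall fun n k => ?_)
  · refine (Tendsto.const_mul _ ((hb k).congr' ?_))
    filter_upwards [hg.eventually (eventually_ge_atTop k)] with n hn
    rw [if_pos hn]
  · rw [Real.norm_eq_abs, abs_of_nonneg]
    · refine mul_le_of_le_one_right (hx0 k) ?_
      split_ifs
      exacts [h.mass_le_one _, zero_le_one]
    · refine mul_nonneg (hx0 k) ?_
      split_ifs
      exacts [h.mass_nonneg _, le_rfl]

/-- Along an ultrafilter on which the mass function converges to its upper or lower limit, all its
shifts by points of the support of `p` have the same limit: in the renewal equation the limit is a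
weighted mean of the limits of the shifts. -/
theorem tendsto_shift (hp : HasSum p 1) {U : Ultrafilter ℕ} (hU : (U : Filter ℕ) ≤ atTop) {l : ℝ}
    (hl : Tendsto a U (𝓝 l))
    (hext : (∀ ε > 0, ∀ᶠ n in atTop, a n < l + ε) ∨ (∀ ε > 0, ∀ᶠ n in atTop, l - ε < a n))
    {k : ℕ} (hk : 0 < p k) : Tendsto (fun n => a (n - k)) U (𝓝 l) := by
  have hsub : ∀ j : ℕ, Tendsto (fun n : ℕ => n - j) U atTop :=
    fun j => (tendsto_sub_atTop_nat j).mono_left hU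
  have hlim : ∀ j : ℕ, ∃ b, Tendsto (fun n : ℕ => a (n - j)) U (𝓝 b) := by
    intro j
    have := (isCompact_Icc (a := (0 : ℝ)) (b := 1)).ultrafilter_le_nhds
      (U.map (fun n : ℕ => a (n - j))) (by
        rw [le_principal_iff]
        exact Ultrafilter.mem_map.2 (Filter.univ_mem' fun n : ℕ => h.mass_mem (n - j)))
    obtain ⟨b, -, hb⟩ := this
    exact ⟨b, hb⟩
  choose b hb using hlim
  have hsum : l = ∑' j, p j * b j := by
    have h1 := h.tendsto_conv_mass h.nonneg hp.summable (g := id) (tendsto_id.mono_left hU) hb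
    refine tendsto_nhds_unique hl (h1.congr' ?_)
    filter_upwards [hU (eventually_ge_atTop 1)] with n hn
    exact (h.mass_eq hn).symm
  have hbb : ∀ j, |b j| ≤ 1 := fun j => by
    have h0 : 0 ≤ b j := ge_of_tendsto' (hb j) fun n => h.mass_nonneg _
    have h1 : b j ≤ 1 := le_of_tendsto' (hb j) fun n => h.mass_le_one _
    rwa [abs_of_nonneg h0]
  have hsm : Summable fun j => p j * b j := by
    refine Summable.of_norm_bounded hp.summable fun j => ?_
    rw [norm_mul, Real.norm_eq_abs, abs_of_nonneg (h.nonneg j)]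
    exact mul_le_of_le_one_right (h.nonneg j) (hbb j)
  -- By extremality all the `l - b j` have the same sign, while their weighted sum vanishes.
  have hz : HasSum (fun j => p j * (l - b j)) 0 := by
    have := (hp.mul_right l).sub hsm.hasSum
    rw [one_mul, ← hsum, sub_self] at this
    exact this.congr_fun (by intro j; ring)
  have hz' : ∀ j, p j * (l - b j) = 0 := by
    rcases hext with hext | hext
    · have hle : ∀ j, b j ≤ l := fun j => le_of_forall_pos_le_add fun ε hε =>
        le_of_tendsto (hb j) (((hsub j).eventually (hext ε hε)).mono fun n hn => hn.le)
      exact fun j => congrFun ((hasSum_zero_iff_of_nonneg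
        (fun j => mul_nonneg (h.nonneg j) (sub_nonneg.2 (hle j)))).1 hz) j
    · have hle : ∀ j, l ≤ b j := fun j => le_of_forall_pos_le_add fun ε hε => by
        have : l - ε ≤ b j :=
          ge_of_tendsto (hb j) (((hsub j).eventually (hext ε hε)).mono fun n hn => hn.le)
        linarith
      have hz2 : HasSum (fun j => p j * (b j - l)) 0 := by
        have := hz.neg
        rw [neg_zero] at this
        refine this.congr_fun ?_
        intro j; ring
      intro j
      have := congrFun ((hasSum_zero_iff_of_nonneg
        (fun j => mul_nonneg (h.nonneg j) (sub_nonneg.2 (hle j)))).1 hz2) j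
      simp only [Pi.zero_apply] at this
      linarith
  have hlk : b k = l := by
    have := (mul_eq_zero.1 (hz' k)).resolve_left hk.ne'
    linarith
  exact hlk ▸ hb k

omit h in
/-- An ultrafilter realizing a cluster value of a sequence. -/
theorem exists_ultrafilter_tendsto {l : ℝ} (hl : ∀ ε > 0, ∃ᶠ n in atTop, |a n - l| < ε) :
    ∃ U : Ultrafilter ℕ, (U : Filter ℕ) ≤ atTop ∧ Tendsto a U (𝓝 l) := by
  have : MapClusterPt l atTop a := by
    rw [(Metric.nhds_basis_ball).mapClusterPt_iff_frequently]
    intro ε hε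
    simpa [Metric.mem_ball, Real.dist_eq] using hl ε hε
  exact mapClusterPt_iff_ultrafilter.1 this

/-- An extremal cluster value `l` of the mass function is the reciprocal of the mean, by passage to
the limit in `∑ tail p k a (n - k) = 1`. -/
theorem extremal_cluster_value (hp : HasSum p 1) {N : ℕ} (hN : ∀ k ≥ N, 0 < p k) {l : ℝ}
    (hl : ∀ ε > 0, ∃ᶠ n in atTop, |a n - l| < ε)
    (hext : (∀ ε > 0, ∀ᶠ n in atTop, a n < l + ε) ∨ (∀ ε > 0, ∀ᶠ n in atTop, l - ε < a n)) :
    (∀ n, psum (tail p) n * l ≤ 1) ∧ (Summable (tail p) → (∑' k, tail p k) * l = 1) := by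
  obtain ⟨U, hU, hUl⟩ := exists_ultrafilter_tendsto hl
  have hsub : Tendsto (fun n : ℕ => n - N) U atTop := (tendsto_sub_atTop_nat N).mono_left hU
  have hsh : ∀ k, Tendsto (fun n => a (n - N - k)) U (𝓝 l) := fun k => by
    -- All indices from `N` on are in the support, so that a shift by `N` makes all limits equal.
    have := h.tendsto_shift hp hU hUl hext (hN (N + k) (by omega))
    simpa only [Nat.sub_sub] using this
  constructor
  · intro n
    have h1 : Tendsto (fun m => ∑ k ∈ Finset.range (n + 1), tail p k * a (m - N - k)) U
        (𝓝 (∑ k ∈ Finset.range (n + 1), tail p k * l)) :=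
      tendsto_finsetSum _ fun k _ => (hsh k).const_mul _
    rw [psum, Finset.sum_mul]
    refine le_of_tendsto h1 ?_
    filter_upwards [hsub.eventually (eventually_ge_atTop n)] with m hm
    have h2 : conv (tail p) a (m - N) = 1 := by rw [h.conv_tail_mass]; rfl
    rw [← h2, conv_eq_sum_range]
    exact Finset.sum_le_sum_of_subset_of_nonneg (Finset.range_mono (by omega))
      fun k _ _ => mul_nonneg (h.tail_nonneg k) (h.mass_nonneg _)
  · intro hs
    have h1 := h.tendsto_conv_mass h.tail_nonneg hs hsub hsh
    rw [h.conv_tail_mass, tsum_mul_right] at h1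
    exact tendsto_nhds_unique h1 tendsto_const_nhds

theorem limsup_isExtremal {l : ℝ} (hl : l = limsup a atTop) :
    (∀ ε > 0, ∃ᶠ n in atTop, |a n - l| < ε) ∧ (∀ ε > 0, ∀ᶠ n in atTop, a n < l + ε) := by
  have hb : IsBoundedUnder (· ≤ ·) atTop a := isBoundedUnder_of ⟨1, h.mass_le_one⟩
  have hb' : IsBoundedUnder (· ≥ ·) atTop a := isBoundedUnder_of ⟨0, h.mass_nonneg⟩
  have h1 : ∀ ε > 0, ∀ᶠ n in atTop, a n < l + ε := fun ε hε =>
    eventually_lt_of_limsup_lt (by linarith) hb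
  refine ⟨fun ε hε => ?_, h1⟩
  have h2 : ∃ᶠ n in atTop, l - ε < a n :=
    frequently_lt_of_lt_limsup hb'.isCoboundedUnder_le (by linarith)
  refine (h2.and_eventually (h1 ε hε)).mono fun n hn => ?_
  rw [abs_lt]
  constructor <;> linarith [hn.1, hn.2]

theorem liminf_isExtremal {l : ℝ} (hl : l = liminf a atTop) :
    (∀ ε > 0, ∃ᶠ n in atTop, |a n - l| < ε) ∧ (∀ ε > 0, ∀ᶠ n in atTop, l - ε < a n) := by
  have hb : IsBoundedUnder (· ≤ ·) atTop a := isBoundedUnder_of ⟨1, h.mass_le_one⟩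
  have hb' : IsBoundedUnder (· ≥ ·) atTop a := isBoundedUnder_of ⟨0, h.mass_nonneg⟩
  have h1 : ∀ ε > 0, ∀ᶠ n in atTop, l - ε < a n := fun ε hε =>
    eventually_lt_of_lt_liminf (by linarith) hb'
  refine ⟨fun ε hε => ?_, h1⟩
  have h2 : ∃ᶠ n in atTop, a n < l + ε :=
    frequently_lt_of_liminf_lt hb.isCoboundedUnder_ge (by linarith)
  refine (h2.and_eventually (h1 ε hε)).mono fun n hn => ?_
  rw [abs_lt]
  constructor <;> linarith [hn.1, hn.2]

/-- The renewal theorem of Erdős, Feller and Pollard, finite mean. -/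
theorem tendsto_mass_of_summable (hp : HasSum p 1) {N : ℕ} (hN : ∀ k ≥ N, 0 < p k)
    (hs : Summable (tail p)) : Tendsto a atTop (𝓝 (∑' k, tail p k)⁻¹) := by
  obtain ⟨h1, h2⟩ := h.limsup_isExtremal rfl
  obtain ⟨h3, h4⟩ := h.liminf_isExtremal rfl
  refine tendsto_of_le_liminf_of_limsup_le
    (eq_inv_of_mul_eq_one_right ((h.extremal_cluster_value hp hN h3 (Or.inr h4)).2 hs)).ge
    (eq_inv_of_mul_eq_one_right ((h.extremal_cluster_value hp hN h1 (Or.inl h2)).2 hs)).le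
    (isBoundedUnder_of ⟨1, h.mass_le_one⟩) (isBoundedUnder_of ⟨0, h.mass_nonneg⟩)

/-- The renewal theorem, infinite mean. -/
theorem tendsto_mass_zero (hp : HasSum p 1) {N : ℕ} (hN : ∀ k ≥ N, 0 < p k)
    (hs : Tendsto (psum (tail p)) atTop atTop) : Tendsto a atTop (𝓝 0) := by
  obtain ⟨h1, h2⟩ := h.limsup_isExtremal rfl
  have h3 := (h.extremal_cluster_value hp hN h1 (Or.inl h2)).1
  set l := limsup a atTop
  have hl : l ≤ 0 := by
    by_contra hpos
    push Not at hpos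
    obtain ⟨n, hn⟩ := ((hs.atTop_mul_const hpos).eventually (eventually_gt_atTop 1)).exists
    exact absurd (h3 n) (not_le.2 hn)
  rw [Metric.tendsto_atTop']
  intro ε hε
  obtain ⟨n, hn⟩ := eventually_atTop.1 (h2 ε hε)
  refine ⟨n, fun m hm => ?_⟩
  rw [Real.dist_eq, sub_zero, abs_of_nonneg (h.mass_nonneg m)]
  linarith [hn m hm.le]

end RenewalPair

/-! ### Tails of regularly varying sequences -/

theorem one_sub_mul_le_rpow_neg {β s : ℝ} (hβ : 0 ≤ β) (hs : -1 < s) :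
    1 - β * s ≤ (1 + s) ^ (-β) := by
  have h1 : Real.log (1 + s) ≤ s := by
    have := Real.log_le_sub_one_of_pos (x := 1 + s) (by linarith)
    linarith
  rw [Real.rpow_def_of_pos (by linarith)]
  have h2 := Real.add_one_le_exp (Real.log (1 + s) * -β)
  nlinarith

/-- The telescoping comparison of `x ^ (-1 - β)` with differences of `x ^ (-β)`. -/
theorem rpow_neg_sub_le {β x : ℝ} (hβ : 0 ≤ β) (hx : 0 < x) :
    x ^ (-β) - (x + 1) ^ (-β) ≤ β * x ^ (-1 - β) ∧
      β * (x + 1) ^ (-1 - β) ≤ x ^ (-β) - (x + 1) ^ (-β) := by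
  have hx1 : 0 < x + 1 := by linarith
  have p1 := Real.rpow_pos_of_pos hx (-β)
  have p2 := Real.rpow_pos_of_pos hx1 (-β)
  have e : ∀ y : ℝ, 0 < y → y ^ (-1 - β) = y ^ (-β) * y⁻¹ := fun y hy => by
    rw [← Real.rpow_neg_one y, ← Real.rpow_add hy]; ring_nf
  constructor
  · have h1 := one_sub_mul_le_rpow_neg hβ (s := x⁻¹) (by linarith [inv_pos.2 hx])
    have h2 : (x + 1) ^ (-β) = x ^ (-β) * (1 + x⁻¹) ^ (-β) := by
      rw [← Real.mul_rpow hx.le (by positivity)]; congr 1; field_simp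
    rw [h2, e x hx]
    nlinarith [mul_le_mul_of_nonneg_left h1 p1.le]
  · have hs : -1 < -(x + 1)⁻¹ := by
      rw [neg_lt_neg_iff]; exact inv_lt_one_of_one_lt₀ (by linarith)
    have h1 := one_sub_mul_le_rpow_neg hβ hs
    have h2 : x ^ (-β) = (x + 1) ^ (-β) * (1 + -(x + 1)⁻¹) ^ (-β) := by
      rw [← Real.mul_rpow hx1.le (by linarith)]; congr 1; field_simp; ring
    rw [h2, e _ hx1]
    nlinarith [mul_le_mul_of_nonneg_left h1 p2.le]

theorem tendsto_sum_range_shift {p : ℕ → ℝ} (hp : HasSum p 1) (n : ℕ) :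
    Tendsto (fun M => ∑ j ∈ Finset.range M, p (n + 1 + j)) atTop (𝓝 (tail p n)) := by
  have h1 : ∀ M, ∑ j ∈ Finset.range M, p (n + 1 + j) =
      ∑ j ∈ Finset.range (M + (n + 1)), p j - psum p n := fun M => by
    rw [add_comm M, Finset.sum_range_add, psum]; ring
  simp only [h1]
  exact (hp.tendsto_sum_nat.comp (tendsto_add_atTop_nat (n + 1))).sub tendsto_const_nhds

theorem tendsto_rpow_neg_natCast_add {β : ℝ} (hβ : 0 < β) (n : ℕ) :
    Tendsto (fun M : ℕ => ((n : ℝ) + M) ^ (-β)) atTop (𝓝 0) :=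
  (tendsto_rpow_neg_atTop hβ).comp
    (tendsto_atTop_add_const_left _ _ tendsto_natCast_atTop_atTop)

/-- Upper half of Karamata's theorem, before the limit. -/
theorem tail_le_of_forall_le {p : ℕ → ℝ} (hp : HasSum p 1) {β C : ℝ} (hβ : 0 < β) (hC : 0 ≤ C)
    {n : ℕ} (hn : 1 ≤ n) (h : ∀ j, n ≤ j → p j ≤ C * (j : ℝ) ^ (-1 - β)) :
    tail p n ≤ C / β * (n : ℝ) ^ (-β) := by
  have hn0 : (0 : ℝ) < n := by exact_mod_cast hn
  refine le_of_tendsto' (tendsto_sum_range_shift hp n) fun M => ?_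
  have h1 : ∀ j ∈ Finset.range M, p (n + 1 + j) ≤
      C / β * (((n : ℝ) + j) ^ (-β) - ((n : ℝ) + (j + 1 : ℕ)) ^ (-β)) := fun j _ => by
    have h2 := h (n + 1 + j) (by omega)
    have h3 := (rpow_neg_sub_le hβ.le (x := (n : ℝ) + j) (by positivity)).2
    push_cast at h2 ⊢
    rw [show (n : ℝ) + 1 + j = n + j + 1 by ring] at h2
    rw [show (n : ℝ) + (j + 1) = n + j + 1 by ring]
    calc p (n + 1 + j) ≤ C * (n + j + 1 : ℝ) ^ (-1 - β) := h2
      _ = C / β * (β * (n + j + 1 : ℝ) ^ (-1 - β)) := by field_simp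
      _ ≤ _ := by gcongr
  refine (Finset.sum_le_sum h1).trans ?_
  rw [← Finset.mul_sum, Finset.sum_range_sub' (fun j : ℕ => ((n : ℝ) + j) ^ (-β))]
  have : 0 ≤ ((n : ℝ) + M) ^ (-β) := by positivity
  have hCβ : 0 ≤ C / β := by positivity
  simp only [Nat.cast_zero, add_zero]
  gcongr
  linarith

/-- Lower half of Karamata's theorem, before the limit. -/
theorem le_tail_of_forall_le {p : ℕ → ℝ} (hp : HasSum p 1) {β C : ℝ} (hβ : 0 < β) (hC : 0 ≤ C)
    {n : ℕ} (h : ∀ j, n < j → C * (j : ℝ) ^ (-1 - β) ≤ p j) :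
    C / β * ((n : ℝ) + 1) ^ (-β) ≤ tail p n := by
  have hlim := ((tendsto_const_nhds (x := ((n : ℝ) + 1) ^ (-β))).sub
    (tendsto_rpow_neg_natCast_add hβ (n + 1))).const_mul (C / β)
  rw [sub_zero] at hlim
  refine le_of_tendsto_of_tendsto' hlim (tendsto_sum_range_shift hp n) fun M => ?_
  have h1 : ∀ j ∈ Finset.range M, C / β * (((n + 1 : ℕ) + (j : ℝ)) ^ (-β) -
      ((n + 1 : ℕ) + ((j + 1 : ℕ) : ℝ)) ^ (-β)) ≤ p (n + 1 + j) := fun j _ => by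
    have h2 := h (n + 1 + j) (by omega)
    have h3 := (rpow_neg_sub_le hβ.le (x := ((n + 1 : ℕ) : ℝ) + j) (by positivity)).1
    push_cast at h2 h3 ⊢
    rw [← add_assoc]
    calc _ ≤ C / β * (β * (n + 1 + j : ℝ) ^ (-1 - β)) := by gcongr
      _ = C * (n + 1 + j : ℝ) ^ (-1 - β) := by field_simp
      _ ≤ _ := h2
  refine le_trans (le_of_eq ?_) (Finset.sum_le_sum h1)
  rw [← Finset.mul_sum, Finset.sum_range_sub' (fun j : ℕ => (((n + 1 : ℕ) : ℝ) + j) ^ (-β))]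
  simp

/-- Karamata's theorem: the tail of a regularly varying probability of index `-(1 + α)`, `α > 0`,
is asymptotic to `n p(n) / α`. -/
theorem RegVarSeq.tendsto_tail_div {p : ℕ → ℝ} {α : ℝ} (hα : 0 < α) (hr : RegVarSeq (1 + α) p)
    (hp : HasSum p 1) :
    Tendsto (fun n : ℕ => tail p n / (((n : ℝ) + 1) * p (n + 1))) atTop (𝓝 α⁻¹) := by
  -- Potter's bounds compare `p` with powers of exponent `-(1 + α) ± ε` from `n + 1` on.
  have hup : ∀ ε, 0 < ε → ε < α → ∀ᶠ n : ℕ in atTop,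
      tail p n / (((n : ℝ) + 1) * p (n + 1)) ≤ 1 / ((n : ℝ) + 1) + Real.exp ε / (α - ε) := by
    intro ε hε hεα
    obtain ⟨N, hN1, hN⟩ := hr ε hε
    filter_upwards [eventually_ge_atTop N] with n hn
    set m := n + 1 with hm
    have hm0 : (0 : ℝ) < m := by positivity
    have hpm := (hN m m (by omega) le_rfl).1
    have h1 := tail_le_of_forall_le hp (β := α - ε) (C := Real.exp ε * (m : ℝ) ^ (1 + α - ε) * p m)
      (n := m) (by linarith) (by positivity) (by omega) (fun j hj => by
        have hj0 : (0 : ℝ) < j := by exact_mod_cast (show 0 < m by omega).trans_le hj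
        refine (hN m j (by omega) hj).2.1.trans (le_of_eq ?_)
        rw [Real.div_rpow hj0.le hm0.le, show -1 - (α - ε) = ε - (1 + α) by ring,
          show 1 + α - ε = -(ε - (1 + α)) by ring, Real.rpow_neg hm0.le]
        field_simp)
    have h2 : tail p n = tail p m + p m := by rw [hm, RenewalPair.tail_succ]; ring
    have hcast : (n : ℝ) + 1 = m := by rw [hm]; push_cast; ring
    rw [hcast, h2, div_le_iff₀ (by positivity)]
    have h3 : (m : ℝ) ^ (1 + α - ε) * (m : ℝ) ^ (-(α - ε)) = m := by
      rw [← Real.rpow_add hm0]; ring_nf; rw [Real.rpow_one]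
    have h4 : Real.exp ε * (m : ℝ) ^ (1 + α - ε) * p m / (α - ε) * (m : ℝ) ^ (-(α - ε)) =
        Real.exp ε / (α - ε) * (m * p m) := by
      calc _ = Real.exp ε / (α - ε) *
            (((m : ℝ) ^ (1 + α - ε) * (m : ℝ) ^ (-(α - ε))) * p m) := by ring
        _ = _ := by rw [h3]
    rw [h4] at h1
    rw [add_mul, one_div_mul_eq_div, mul_div_cancel_left₀ _ hm0.ne']
    linarith
  have hlow : ∀ ε, 0 < ε → ∀ᶠ n : ℕ in atTop,
      Real.exp (-ε) / (α + ε) ≤ tail p n / (((n : ℝ) + 1) * p (n + 1)) := by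
    intro ε hε
    obtain ⟨N, hN1, hN⟩ := hr ε hε
    filter_upwards [eventually_ge_atTop N] with n hn
    have hm0 : (0 : ℝ) < n + 1 := by positivity
    have hpm := (hN (n + 1) (n + 1) (by omega) le_rfl).1
    have h1 := le_tail_of_forall_le hp (β := α + ε)
      (C := Real.exp (-ε) * ((n : ℝ) + 1) ^ (1 + α + ε) * p (n + 1))
      (n := n) (by linarith) (by positivity) (fun j hj => by
        have hj0 : (0 : ℝ) < j := by exact_mod_cast (show 0 < j by omega)
        have h2 := (hN (n + 1) j (by omega) (by omega)).2.2
        push_cast at h2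
        rw [Real.div_rpow hj0.le hm0.le] at h2
        have e1 : (j : ℝ) ^ (ε + (1 + α)) * (j : ℝ) ^ (-1 - (α + ε)) = 1 := by
          rw [← Real.rpow_add hj0]; ring_nf; rw [Real.rpow_zero]
        have e2 : Real.exp ε * Real.exp (-ε) = 1 := by rw [← Real.exp_add]; simp
        rw [show 1 + α + ε = ε + (1 + α) by ring]
        have h3 := mul_le_mul_of_nonneg_left h2
          (show 0 ≤ Real.exp (-ε) * ((n : ℝ) + 1) ^ (ε + (1 + α)) * (j : ℝ) ^ (-1 - (α + ε)) by
            positivity)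
        calc _ = Real.exp (-ε) * ((n : ℝ) + 1) ^ (ε + (1 + α)) * (j : ℝ) ^ (-1 - (α + ε)) *
              p (n + 1) := by ring
          _ ≤ _ := h3
          _ = (Real.exp ε * Real.exp (-ε)) * ((j : ℝ) ^ (ε + (1 + α)) *
              (j : ℝ) ^ (-1 - (α + ε))) * p j := by field_simp
          _ = p j := by rw [e1, e2]; ring)
    rw [le_div_iff₀ (by positivity)]
    have h3 : ((n : ℝ) + 1) ^ (1 + α + ε) * ((n : ℝ) + 1) ^ (-(α + ε)) = n + 1 := by
      rw [← Real.rpow_add hm0]; ring_nf; rw [Real.rpow_one]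
    calc Real.exp (-ε) / (α + ε) * ((n + 1) * p (n + 1))
        = Real.exp (-ε) / (α + ε) * ((((n : ℝ) + 1) ^ (1 + α + ε) *
            ((n : ℝ) + 1) ^ (-(α + ε))) * p (n + 1)) := by rw [h3]
      _ = _ := by ring
      _ ≤ _ := h1
  rw [tendsto_order]
  constructor
  · intro b hb
    have hc : ContinuousAt (fun ε : ℝ => Real.exp (-ε) / (α + ε)) 0 := by
      refine ContinuousAt.div (by fun_prop) (by fun_prop) (by simpa using hα.ne')
    have hc' : Tendsto (fun ε : ℝ => Real.exp (-ε) / (α + ε)) (𝓝[>] 0) (𝓝 α⁻¹) := by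
      have := hc.tendsto.mono_left (nhdsWithin_le_nhds (s := Set.Ioi 0))
      simpa using this
    obtain ⟨ε, hε, hε0⟩ := ((hc'.eventually (lt_mem_nhds hb)).and self_mem_nhdsWithin).exists
    exact (hlow ε hε0).mono fun n hn => hε.trans_le hn
  · intro b hb
    have hc : ContinuousAt (fun ε : ℝ => Real.exp ε / (α - ε)) 0 := by
      refine ContinuousAt.div (by fun_prop) (by fun_prop) (by simpa using hα.ne')
    have hc' : Tendsto (fun ε : ℝ => Real.exp ε / (α - ε)) (𝓝[>] 0) (𝓝 α⁻¹) := by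
      have := hc.tendsto.mono_left (nhdsWithin_le_nhds (s := Set.Ioi 0))
      simpa using this
    obtain ⟨ε, ⟨hε, hε0⟩, hεα⟩ := (((hc'.eventually (gt_mem_nhds hb)).and
      self_mem_nhdsWithin).and (nhdsWithin_le_nhds (gt_mem_nhds hα))).exists
    have h1 : Tendsto (fun n : ℕ => 1 / ((n : ℝ) + 1) + Real.exp ε / (α - ε)) atTop
        (𝓝 (0 + Real.exp ε / (α - ε))) :=
      tendsto_one_div_add_atTop_nhds_zero_nat.add tendsto_const_nhds
    rw [zero_add] at h1
    filter_upwards [hup ε hε0 hεα, h1.eventually (gt_mem_nhds hε)] with n h2 h3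
    exact h2.trans_lt h3

/-! ### Doubling bounds for the mass function -/

/-- The sequence `a` is eventually positive, and its values on `[n / 4, n]` are bounded by a
multiple of `a n`. -/
def DoublingSeq (a : ℕ → ℝ) : Prop :=
  ∃ C : ℝ, ∃ N : ℕ, ∀ n ≥ N, 0 < a n ∧ ∀ m, n ≤ 4 * m → m ≤ n → a m ≤ C * a n

namespace RenewalPair

variable {p a : ℕ → ℝ} (h : RenewalPair p a)
include h

theorem doublingSeq_of_tendsto {c : ℝ} (hc : 0 < c) (ha : Tendsto a atTop (𝓝 c)) :
    DoublingSeq a := by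
  obtain ⟨N, hN⟩ := eventually_atTop.1 (ha.eventually (lt_mem_nhds (half_lt_self hc)))
  refine ⟨2 / c, N, fun n hn => ⟨(half_pos hc).trans (hN n hn), fun m _ _ => ?_⟩⟩
  calc a m ≤ 1 := h.mass_le_one m
    _ = 2 / c * (c / 2) := by field_simp
    _ ≤ 2 / c * a n := by have := hN n hn; gcongr

theorem eventually_conv_mass_le (ha : Tendsto a atTop (𝓝 0)) {ε : ℝ} (hε : 0 < ε) (k : ℕ) :
    ∀ᶠ n in atTop, conv a a (n - k) ≤ ε * psum a n := by
  obtain ⟨N, hN⟩ := eventually_atTop.1 (ha.eventually (gt_mem_nhds (half_pos hε)))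
  filter_upwards [eventually_ge_atTop (2 * N + k)] with n hn
  have h1 := conv_self_le h.mass_nonneg (n := n - k) (M := ε / 2)
    fun j hj _ => (hN j (by omega)).le
  have h2 := psum_mono h.mass_nonneg (Nat.sub_le n k)
  nlinarith

/-- If the mass function tends to `0`, the identities `(n + 1) a (n + 1) = ∑ q k (a * a) (n - k)`
and `psum a n = ∑ tail p k (a * a) (n - k)` may be compared term by term, as finitely many terms do
not count. -/
theorem eventually_abs_sub_le {q : ℕ → ℝ} {c ε : ℝ} (hε : 0 < ε) (ha : Tendsto a atTop (𝓝 0))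
    (hq : ∀ᶠ k in atTop, |q k - c * tail p k| ≤ ε * tail p k) :
    ∀ᶠ n in atTop, |conv q (conv a a) n - c * psum a n| ≤ 2 * ε * psum a n := by
  obtain ⟨K, hK⟩ := eventually_atTop.1 hq
  have hsmall : ∀ᶠ n in atTop, ∀ k ∈ Finset.range K,
      |q k - c * tail p k| * conv a a (n - k) ≤ ε / K * psum a n := by
    rw [eventually_all_finset]
    intro k hk
    have hK0 : (0 : ℝ) < K := by exact_mod_cast (Nat.zero_le k).trans_lt (Finset.mem_range.1 hk)
    have hd : 0 < |q k - c * tail p k| + 1 := by positivity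
    filter_upwards [h.eventually_conv_mass_le ha
      (ε := ε / K / (|q k - c * tail p k| + 1)) (by positivity) k] with n hn
    have h1 := h.conv_mass_nonneg (n - k)
    calc |q k - c * tail p k| * conv a a (n - k)
        ≤ (|q k - c * tail p k| + 1) * conv a a (n - k) := by nlinarith
      _ ≤ (|q k - c * tail p k| + 1) * (ε / K / (|q k - c * tail p k| + 1) * psum a n) := by
        gcongr
      _ = ε / K * psum a n := by field_simp
  filter_upwards [hsmall, eventually_ge_atTop K] with n hn hnK
  have hA : 0 ≤ psum a n := zero_le_one.trans (h.one_le_psum_mass n)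
  have e1 : conv q (conv a a) n - c * psum a n =
      ∑ k ∈ Finset.range (n + 1), (q k - c * tail p k) * conv a a (n - k) := by
    rw [h.psum_mass_eq_conv, conv_eq_sum_range, conv_eq_sum_range, Finset.mul_sum,
      ← Finset.sum_sub_distrib]
    exact Finset.sum_congr rfl fun k _ => by ring
  rw [e1]
  refine (Finset.abs_sum_le_sum_abs _ _).trans ?_
  have h1 : ∀ k ∈ Finset.range (n + 1), |(q k - c * tail p k) * conv a a (n - k)| ≤
      ε * (tail p k * conv a a (n - k)) + if k < K then ε / K * psum a n else 0 := by
    intro k _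
    have hc := h.conv_mass_nonneg (n - k)
    rw [abs_mul, abs_of_nonneg hc]
    split_ifs with hkK
    · have := hn k (Finset.mem_range.2 hkK)
      have := mul_nonneg hε.le (mul_nonneg (h.tail_nonneg k) hc)
      linarith
    · have := mul_le_mul_of_nonneg_right (hK k (not_lt.1 hkK)) hc
      linarith
  refine (Finset.sum_le_sum h1).trans ?_
  rw [Finset.sum_add_distrib, ← Finset.mul_sum, ← conv_eq_sum_range (tail p) (conv a a),
    ← h.psum_mass_eq_conv, ← Finset.sum_filter, Finset.sum_const, nsmul_eq_mul]
  have h2 : ((Finset.range (n + 1)).filter (· < K)).card = K := by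
    rw [show (Finset.range (n + 1)).filter (· < K) = Finset.range K by ext; simp; omega,
      Finset.card_range]
  rw [h2]
  have h3 : (K : ℝ) * (ε / K * psum a n) ≤ ε * psum a n := by
    rcases Nat.eq_zero_or_pos K with rfl | hK0
    · simpa using mul_nonneg hε.le hA
    · have : (0 : ℝ) < K := by exact_mod_cast hK0
      exact le_of_eq (by field_simp)
  linarith

/-- The recurrent case with infinite mean and positive index `α`: then `n a(n)` is asymptotic to
`α ∑_{k < n} a(k)`, of which only the order of magnitude is needed. -/
theorem doublingSeq_of_recurrent {α : ℝ} (hα : 0 < α) (hr : RegVarSeq (1 + α) p)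
    (hp : HasSum p 1) (hs : Tendsto (psum (tail p)) atTop atTop) : DoublingSeq a := by
  obtain ⟨N₁, -, hN₁⟩ := hr 1 one_pos
  have hpos : ∀ k ≥ N₁, 0 < p k := fun k hk => (hN₁ k k hk le_rfl).1
  have ha := h.tendsto_mass_zero hp hpos hs
  have hq : ∀ᶠ k : ℕ in atTop, |((k : ℝ) + 1) * p (k + 1) - α * tail p k| ≤ α / 4 * tail p k := by
    have h1 : Tendsto (fun n : ℕ => (tail p n / (((n : ℝ) + 1) * p (n + 1)))⁻¹) atTop (𝓝 α) := by
      simpa using (hr.tendsto_tail_div hα hp).inv₀ (inv_ne_zero hα.ne')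
    filter_upwards [Metric.tendsto_nhds.1 h1 (α / 4) (by linarith), h1.eventually (lt_mem_nhds hα)]
      with k hk hk0
    rw [Real.dist_eq, inv_div] at hk
    rw [inv_div] at hk0
    have ht : 0 < tail p k := by
      refine (h.tail_nonneg k).lt_of_ne' fun h0 => ?_
      rw [h0, div_zero] at hk0
      exact lt_irrefl _ hk0
    have e : ((k : ℝ) + 1) * p (k + 1) - α * tail p k =
        (((k : ℝ) + 1) * p (k + 1) / tail p k - α) * tail p k := by field_simp
    rw [e, abs_mul, abs_of_pos ht]
    gcongr
  obtain ⟨N, hN⟩ := eventually_atTop.1 (h.eventually_abs_sub_le (by linarith) ha hq)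
  have hb : ∀ n ≥ N, α / 2 * psum a n ≤ ((n : ℝ) + 1) * a (n + 1) ∧
      ((n : ℝ) + 1) * a (n + 1) ≤ 3 / 2 * α * psum a n := fun n hn => by
    have h1 := hN n hn
    rw [← h.succ_mul_mass_succ, abs_le] at h1
    constructor <;> linarith [h1.1, h1.2]
  -- The bounds differ by a factor `3`, and `m ≥ n / 4` costs a factor `4`.
  refine ⟨12, 4 * N + 4, fun n hn => ?_⟩
  obtain ⟨n, rfl⟩ : ∃ k, n = k + 1 := ⟨n - 1, by omega⟩
  have hn0 : (0 : ℝ) < (n : ℝ) + 1 := by positivity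
  have hbn := (hb n (by omega)).1
  have hA := h.one_le_psum_mass n
  refine ⟨by
    by_contra hle
    push Not at hle
    nlinarith [mul_nonpos_of_nonneg_of_nonpos hn0.le hle, mul_pos hα (zero_lt_one.trans_le hA)],
    fun m hm hmn => ?_⟩
  obtain ⟨m, rfl⟩ : ∃ k, m = k + 1 := ⟨m - 1, by omega⟩
  have hbm := (hb m (by omega)).2
  have hAm := psum_mono h.mass_nonneg (show m ≤ n by omega)
  have hcast : (n : ℝ) + 1 ≤ 4 * (m + 1) := by exact_mod_cast hm
  have h1 : ((n : ℝ) + 1) * a (m + 1) ≤ ((n : ℝ) + 1) * (12 * a (n + 1)) := by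
    calc ((n : ℝ) + 1) * a (m + 1) ≤ 4 * (m + 1) * a (m + 1) := by
          gcongr
          exact h.mass_nonneg _
      _ ≤ 6 * α * psum a m := by linarith
      _ ≤ 6 * α * psum a n := by gcongr
      _ ≤ ((n : ℝ) + 1) * (12 * a (n + 1)) := by linarith
  exact le_of_mul_le_mul_left h1 hn0

end RenewalPair

/-- A regularly varying sequence is comparable to a constant on each window `[n / L, n]`. -/
theorem RegVarSeq.exists_window {β : ℝ} (hβ : 0 ≤ β) {p : ℕ → ℝ} (hr : RegVarSeq β p) {L : ℕ}
    (hL : 1 ≤ L) : ∃ C : ℝ, 1 ≤ C ∧ ∃ N : ℕ, ∀ n ≥ N, ∀ m, n ≤ L * m → m ≤ n →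
      0 < p m ∧ p m ≤ C * p n ∧ p n ≤ C * p m := by
  obtain ⟨N, hN1, hN⟩ := hr 1 one_pos
  have hL1 : (1 : ℝ) ≤ L := by exact_mod_cast hL
  refine ⟨Real.exp 1 * (L : ℝ) ^ (1 + β), ?_, L * N, fun n hn m hnm hmn => ?_⟩
  · exact one_le_mul_of_one_le_of_one_le (Real.one_le_exp zero_le_one)
      (Real.one_le_rpow hL1 (by linarith))
  have hm : N ≤ m := Nat.le_of_mul_le_mul_left (hn.trans hnm) (by omega)
  have hm0 : (0 : ℝ) < m := by exact_mod_cast (show 0 < m by omega)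
  obtain ⟨h1, h2, h3⟩ := hN m n hm hmn
  have hn1 := (hN n n (hm.trans hmn) le_rfl).1
  have hx1 : (1 : ℝ) ≤ n / m := (one_le_div hm0).2 (by exact_mod_cast hmn)
  have hxL : (n : ℝ) / m ≤ L := (div_le_iff₀ hm0).2 (by exact_mod_cast hnm)
  have h4 : ((n : ℝ) / m) ^ (1 + β) ≤ (L : ℝ) ^ (1 + β) :=
    Real.rpow_le_rpow (by linarith) hxL (by linarith)
  have h5 : ((n : ℝ) / m) ^ (1 - β) ≤ (L : ℝ) ^ (1 + β) :=
    (Real.rpow_le_rpow_of_exponent_le hx1 (by linarith)).trans h4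
  exact ⟨h1, h3.trans (by gcongr), h2.trans (by gcongr)⟩

theorem sum_range_inv_sqrt_le (J : ℕ) :
    ∑ k ∈ Finset.range J, (√((k : ℝ) + 1))⁻¹ ≤ 2 * √(J : ℝ) := by
  induction J with
  | zero => simp
  | succ J ih =>
    rw [Finset.sum_range_succ]
    push_cast
    have h0 : (0 : ℝ) ≤ J := Nat.cast_nonneg J
    set s := √(J : ℝ)
    set t := √((J : ℝ) + 1) with ht
    have hs : s ^ 2 = J := Real.sq_sqrt h0
    have ht2 : t ^ 2 = (J : ℝ) + 1 := Real.sq_sqrt (by linarith)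
    have ht0 : 0 < t := Real.sqrt_pos.2 (by linarith)
    have hinv : t * t⁻¹ = 1 := mul_inv_cancel₀ ht0.ne'
    have key : t * t⁻¹ ≤ t * (2 * t - 2 * s) := by
      rw [hinv]; nlinarith [sq_nonneg (t - s)]
    have := le_of_mul_le_mul_left key ht0
    linarith

/-- The first moment of `p`, truncated at a small fraction of `n`, is a small fraction of
`∑_{k ≤ n} tail p k`. -/
def SmallTruncatedMean (p : ℕ → ℝ) : Prop :=
  ∀ δ : ℝ, 0 < δ → ∃ L : ℕ, 4 ≤ L ∧ ∀ᶠ n : ℕ in atTop,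
    ∑ k ∈ Finset.range (n / L), ((k : ℝ) + 1) * p (k + 1) ≤ δ * psum (tail p) n

namespace RenewalPair

variable {p a : ℕ → ℝ} (h : RenewalPair p a)
include h

/-- In the transient case the tails are bounded below, so that their sum is of order `n`. -/
theorem smallTruncatedMean_of_transient {ρ : ℝ} (hρ : 0 < ρ) (hp : ∀ n, ρ ≤ tail p n) :
    SmallTruncatedMean p := by
  intro δ hδ
  obtain ⟨L, hL⟩ := exists_nat_ge (max 4 (1 / (δ * ρ)))
  have hL4 : 4 ≤ L := by exact_mod_cast (le_max_left _ _).trans hL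
  have hL0 : (0 : ℝ) < L := by exact_mod_cast (show 0 < L by omega)
  have hLδ : 1 ≤ L * (δ * ρ) := by
    have := (le_max_right _ _).trans hL
    rwa [div_le_iff₀ (by positivity)] at this
  refine ⟨L, hL4, Eventually.of_forall fun n => ?_⟩
  have h1 : ((n : ℝ) + 1) * ρ ≤ psum (tail p) n := by
    have := Finset.card_nsmul_le_sum (Finset.range (n + 1)) (tail p) ρ fun k _ => hp k
    simpa [psum] using this
  have h2 : ((n / L : ℕ) : ℝ) * L ≤ n := by exact_mod_cast Nat.div_mul_le_self n L
  have h4 : ∑ k ∈ Finset.range (n / L), p (k + 1) ≤ 1 := by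
    have h5 := h.psum_le (n / L)
    rw [psum, Finset.sum_range_succ', h.zero, add_zero] at h5
    exact h5
  calc ∑ k ∈ Finset.range (n / L), ((k : ℝ) + 1) * p (k + 1)
      ≤ ∑ k ∈ Finset.range (n / L), ((n / L : ℕ) : ℝ) * p (k + 1) := by
        refine Finset.sum_le_sum fun k hk => mul_le_mul_of_nonneg_right ?_ (h.nonneg _)
        exact_mod_cast Finset.mem_range.1 hk
    _ ≤ ((n / L : ℕ) : ℝ) := by
        rw [← Finset.mul_sum]
        exact mul_le_of_le_one_right (Nat.cast_nonneg _) h4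
    _ ≤ ((n / L : ℕ) : ℝ) * (L * (δ * ρ)) := le_mul_of_one_le_right (Nat.cast_nonneg _) hLδ
    _ = δ * ((((n / L : ℕ) : ℝ) * L) * ρ) := by ring
    _ ≤ δ * (((n : ℝ) + 1) * ρ) := by gcongr; linarith
    _ ≤ δ * psum (tail p) n := by gcongr

/-- The tails up to `n / 2` are at least the mass of `p` on `[n / 2, n]`. -/
theorem exists_sq_mul_le_psum_tail {β : ℝ} (hβ : 0 ≤ β) (hr : RegVarSeq β p) :
    ∃ C : ℝ, 0 < C ∧ ∀ᶠ n : ℕ in atTop, (n : ℝ) ^ 2 * p n ≤ C * psum (tail p) n := by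
  obtain ⟨C, hC, N, hN⟩ := hr.exists_window hβ (L := 4) (by norm_num)
  refine ⟨9 * C, by linarith, ?_⟩
  filter_upwards [eventually_ge_atTop (max N 9)] with n hn
  have hnN : N ≤ n := (le_max_left _ _).trans hn
  have hn9 : 9 ≤ n := (le_max_right _ _).trans hn
  have hpn := (hN n hnN n (by omega) le_rfl).1
  set t := n / 2 with ht
  have h1 : ∀ k ∈ Finset.range (t + 1), (t : ℝ) * (p n / C) ≤ tail p k := by
    intro k hk
    have hkt : k ≤ t := by have := Finset.mem_range.1 hk; omega
    have h2 : psum p n = psum p t + ∑ j ∈ Finset.range (n - t), p (t + 1 + j) := by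
      rw [psum, psum, ← Finset.sum_range_add, show t + 1 + (n - t) = n + 1 by omega]
    have h3 : (t : ℝ) * (p n / C) ≤ ∑ j ∈ Finset.range (n - t), p (t + 1 + j) := by
      have h4 := Finset.card_nsmul_le_sum (Finset.range (n - t)) (fun j => p (t + 1 + j)) (p n / C)
        fun j hj => by
          have := Finset.mem_range.1 hj
          rw [div_le_iff₀ (by linarith), mul_comm]
          exact (hN n hnN (t + 1 + j) (by omega) (by omega)).2.2
      rw [Finset.card_range, nsmul_eq_mul] at h4
      refine le_trans ?_ h4
      gcongr
      omega
    have h5 := h.psum_le n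
    have h6 := psum_mono h.nonneg hkt
    rw [tail]
    linarith
  have h7 := Finset.card_nsmul_le_sum _ _ _ h1
  rw [Finset.card_range, nsmul_eq_mul] at h7
  have h8 : psum (tail p) t ≤ psum (tail p) n := psum_mono h.tail_nonneg (by omega)
  have h9 : (n : ℝ) ^ 2 ≤ 9 * (((t + 1 : ℕ) : ℝ) * t) := by
    have h10 : (n : ℝ) ≤ 2 * t + 1 := by exact_mod_cast (show n ≤ 2 * t + 1 by omega)
    have h11 : (4 : ℝ) ≤ t := by exact_mod_cast (show 4 ≤ t by omega)
    push_cast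
    nlinarith [Nat.cast_nonneg (α := ℝ) n]
  have hC0 : (0 : ℝ) < C := by linarith
  calc (n : ℝ) ^ 2 * p n ≤ 9 * (((t + 1 : ℕ) : ℝ) * t) * p n := by gcongr
    _ = 9 * C * (((t + 1 : ℕ) : ℝ) * (t * (p n / C))) := by field_simp
    _ ≤ 9 * C * psum (tail p) n := by
      gcongr
      exact h7.trans h8

/-- For index `α = 0` the sequence `k p(k)` is slowly varying. By Potter's bound its sum up to
`n / L` is at most of order `L ^ (-1 / 2) n ^ 2 p(n)`, and `n ^ 2 p(n)` is at most of the order of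
the sum of the tails. -/
theorem smallTruncatedMean_of_regVarSeq_one (hr : RegVarSeq 1 p)
    (hs : Tendsto (psum (tail p)) atTop atTop) : SmallTruncatedMean p := by
  intro δ hδ
  obtain ⟨C, hC, hsq⟩ := h.exists_sq_mul_le_psum_tail zero_le_one hr
  obtain ⟨N, hN1, hN⟩ := hr (1 / 2) (by norm_num)
  set D := Real.exp (1 / 2) * 2 * C
  have hD : 0 < D := by positivity
  obtain ⟨L, hL⟩ := exists_nat_ge (max 4 ((2 * D / δ) ^ 2))
  have hL4 : 4 ≤ L := by exact_mod_cast (le_max_left _ _).trans hL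
  have hL0 : (0 : ℝ) < L := by exact_mod_cast (show 0 < L by omega)
  have hLs : 2 * D / δ ≤ √(L : ℝ) := Real.le_sqrt_of_sq_le ((le_max_right _ _).trans hL)
  have hLs0 : 0 < √(L : ℝ) := Real.sqrt_pos.2 hL0
  refine ⟨L, hL4, ?_⟩
  filter_upwards [hsq, hs.eventually (eventually_ge_atTop ((N : ℝ) * N * (2 / δ))),
    eventually_ge_atTop N] with n hn hns hnN
  have hn0 : (0 : ℝ) < n := by exact_mod_cast (show 0 < n by omega)
  have hpn := (hN n n hnN le_rfl).1
  set J := n / L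
  have hJ : (J : ℝ) * L ≤ n := by exact_mod_cast Nat.div_mul_le_self n L
  have hterm : ∀ k ∈ Finset.range J, ((k : ℝ) + 1) * p (k + 1) ≤
      (if k < N then (N : ℝ) else 0) +
        Real.exp (1 / 2) * (n * √(n : ℝ) * p n) * (√((k : ℝ) + 1))⁻¹ := by
    intro k hk
    have hkJ := Finset.mem_range.1 hk
    split_ifs with hkN
    · have hk1 : ((k : ℝ) + 1) ≤ N := by exact_mod_cast hkN
      have hp1 : p (k + 1) ≤ 1 := by
        refine le_trans ?_ (h.psum_le (k + 1))
        exact Finset.single_le_sum (f := p) (fun i _ => h.nonneg i) (by simp)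
      have : ((k : ℝ) + 1) * p (k + 1) ≤ N := by
        calc ((k : ℝ) + 1) * p (k + 1) ≤ ((k : ℝ) + 1) * 1 := by gcongr
          _ ≤ N := by linarith
      have : 0 ≤ Real.exp (1 / 2) * (n * √(n : ℝ) * p n) * (√((k : ℝ) + 1))⁻¹ := by positivity
      linarith
    · have hkn : k + 1 ≤ n := (Nat.succ_le_of_lt hkJ).trans (Nat.div_le_self n L)
      have h1 := (hN (k + 1) n (by omega) hkn).2.2
      push_cast at h1
      have hk0 : (0 : ℝ) < (k : ℝ) + 1 := by positivity
      have h2 : ((n : ℝ) / (k + 1)) ^ ((1 : ℝ) / 2 + 1) =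
          (√(n : ℝ) * (√((k : ℝ) + 1))⁻¹) * (n / (k + 1)) := by
        rw [Real.rpow_add (by positivity), Real.rpow_one, ← Real.sqrt_eq_rpow,
          Real.sqrt_div hn0.le, div_eq_mul_inv (√(n : ℝ))]
      rw [h2] at h1
      rw [zero_add]
      calc ((k : ℝ) + 1) * p (k + 1) ≤ ((k : ℝ) + 1) * (Real.exp (1 / 2) *
            ((√(n : ℝ) * (√((k : ℝ) + 1))⁻¹) * (n / (k + 1))) * p n) := by gcongr
        _ = _ := by field_simp
  have hfirst : ∑ k ∈ Finset.range J, (if k < N then (N : ℝ) else 0) ≤ N * N := by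
    rw [← Finset.sum_filter, Finset.sum_const, nsmul_eq_mul]
    gcongr
    calc ((Finset.range J).filter (· < N)).card ≤ (Finset.range N).card :=
          Finset.card_le_card fun k hk => by
            simp only [Finset.mem_filter] at hk; exact Finset.mem_range.2 hk.2
      _ = N := Finset.card_range N
  have hsqrtJ : √(J : ℝ) ≤ √(n : ℝ) / √(L : ℝ) := by
    rw [le_div_iff₀ hLs0, ← Real.sqrt_mul (Nat.cast_nonneg J)]
    exact Real.sqrt_le_sqrt hJ
  have hss : √(n : ℝ) * √(n : ℝ) = n := Real.mul_self_sqrt hn0.le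
  have hS : 0 ≤ psum (tail p) n := zero_le_one.trans (h.one_le_psum_tail n)
  have hsecond : Real.exp (1 / 2) * (n * √(n : ℝ) * p n) *
      ∑ k ∈ Finset.range J, (√((k : ℝ) + 1))⁻¹ ≤ δ / 2 * psum (tail p) n := by
    calc _ ≤ Real.exp (1 / 2) * (n * √(n : ℝ) * p n) * (2 * (√(n : ℝ) / √(L : ℝ))) := by
          gcongr
          exact (sum_range_inv_sqrt_le J).trans (by gcongr)
      _ = Real.exp (1 / 2) * 2 / √(L : ℝ) * ((√(n : ℝ) * √(n : ℝ)) * n * p n) := by ring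
      _ = Real.exp (1 / 2) * 2 / √(L : ℝ) * ((n : ℝ) ^ 2 * p n) := by rw [hss]; ring
      _ ≤ Real.exp (1 / 2) * 2 / √(L : ℝ) * (C * psum (tail p) n) := by gcongr
      _ = D / √(L : ℝ) * psum (tail p) n := by ring
      _ ≤ δ / 2 * psum (tail p) n := by
          refine mul_le_mul_of_nonneg_right ?_ hS
          rw [div_le_iff₀ hLs0]
          rw [div_le_iff₀ hδ] at hLs
          linarith
  have hN2 : (N : ℝ) * N ≤ δ / 2 * psum (tail p) n := by
    calc (N : ℝ) * N = δ / 2 * ((N : ℝ) * N * (2 / δ)) := by field_simp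
      _ ≤ _ := by gcongr
  calc _ ≤ _ := Finset.sum_le_sum hterm
    _ = _ := Finset.sum_add_distrib
    _ ≤ δ / 2 * psum (tail p) n + δ / 2 * psum (tail p) n := by
      rw [← Finset.mul_sum]
      exact add_le_add (hfirst.trans hN2) hsecond
    _ = _ := by ring

end RenewalPair

namespace RenewalPair

variable {p a : ℕ → ℝ} (h : RenewalPair p a)
include h

/-- The lower bound by the trajectories with one jump of order `n`. -/
theorem exists_mul_sq_le_mass {β : ℝ} (hβ : 0 ≤ β) (hr : RegVarSeq β p) :
    ∃ c : ℝ, 0 < c ∧ ∀ᶠ n : ℕ in atTop, p n * psum a n ^ 2 ≤ c * a n := by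
  obtain ⟨C, hC, N, hN⟩ := hr.exists_window hβ (L := 4) (by norm_num)
  refine ⟨2 * C * 64 ^ 2, by linarith, ?_⟩
  rw [eventually_atTop]
  refine ⟨N + 16, fun n hn => ?_⟩
  obtain ⟨n, rfl⟩ : ∃ k, n = k + 1 := ⟨n - 1, by omega⟩
  have hpn := (hN (n + 1) (by omega) (n + 1) (by omega) le_rfl).1
  have hn0 : (0 : ℝ) < (n : ℝ) + 1 := by positivity
  have h1 : ∀ k ∈ Finset.range (n / 2 + 1),
      ((n : ℝ) + 1) / 2 * (p (n + 1) / C) * conv a a k ≤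
        conv a a k * (((n - k : ℕ) : ℝ) + 1) * p (n - k + 1) := by
    intro k hk
    have hk' : k ≤ n / 2 := by have := Finset.mem_range.1 hk; omega
    have h2 : p (n + 1) / C ≤ p (n - k + 1) := by
      rw [div_le_iff₀ (by linarith), mul_comm]
      exact (hN (n + 1) (by omega) (n - k + 1) (by omega) (by omega)).2.2
    have h3 : ((n : ℝ) + 1) / 2 ≤ ((n - k : ℕ) : ℝ) + 1 := by
      have : n + 1 ≤ 2 * (n - k + 1) := by omega
      have : (n : ℝ) + 1 ≤ 2 * (((n - k : ℕ) : ℝ) + 1) := by exact_mod_cast this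
      linarith
    have h4 := h.conv_mass_nonneg k
    calc _ = conv a a k * (((n : ℝ) + 1) / 2) * (p (n + 1) / C) := by ring
      _ ≤ _ := by gcongr
  have h2 : ((n : ℝ) + 1) / 2 * (p (n + 1) / C) * psum (conv a a) (n / 2) ≤
      ((n : ℝ) + 1) * a (n + 1) := by
    rw [h.succ_mul_mass_succ, conv_comm _ (conv a a), conv_eq_sum_range, psum, Finset.mul_sum]
    refine (Finset.sum_le_sum h1).trans ?_
    simp only [mul_assoc]
    exact Finset.sum_le_sum_of_subset_of_nonneg (Finset.range_mono (by omega)) fun k _ _ =>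
      mul_nonneg (h.conv_mass_nonneg k) (mul_nonneg (by positivity) (h.nonneg _))
  have h3 := mul_le_psum_conv h.mass_nonneg h.mass_nonneg (show 2 * (n / 4) ≤ n / 2 by omega)
  have h4 : psum a (n + 1) ≤ 64 * psum a (n / 4) := by
    have h5 := h.psum_mass_le_of_le (show n + 1 ≤ 4 * (n / 2) by omega)
    have h6 := h.psum_mass_le_of_le (show n / 2 ≤ 4 * (n / 4) by omega)
    linarith
  have hA := h.one_le_psum_mass (n / 4)
  have hA' := h.one_le_psum_mass (n + 1)
  have hC0 : 0 < C := by linarith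
  have h5 : ((n : ℝ) + 1) * (p (n + 1) * psum a (n + 1) ^ 2) ≤
      ((n : ℝ) + 1) * (2 * C * 64 ^ 2 * a (n + 1)) := by
    calc ((n : ℝ) + 1) * (p (n + 1) * psum a (n + 1) ^ 2)
        ≤ ((n : ℝ) + 1) * (p (n + 1) * (64 * psum a (n / 4)) ^ 2) := by gcongr
      _ = 2 * C * 64 ^ 2 * (((n : ℝ) + 1) / 2 * (p (n + 1) / C) *
            (psum a (n / 4) * psum a (n / 4))) := by field_simp
      _ ≤ 2 * C * 64 ^ 2 * (((n : ℝ) + 1) / 2 * (p (n + 1) / C) * psum (conv a a) (n / 2)) := by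
          gcongr
      _ ≤ 2 * C * 64 ^ 2 * (((n : ℝ) + 1) * a (n + 1)) := by gcongr
      _ = _ := by ring
  exact le_of_mul_le_mul_left h5 hn0

/-- The recursive upper bound: in `(n + 1) a (n + 1) = ∑ (k + 1) p (k + 1) (a * a) (n - k)`, the
large `k` contribute at most `(n + 1) p (n + 1) (psum a (n + 1)) ^ 2` up to a constant, and the
small `k` at most a small multiple of `n` times the values of `a` on `[(n + 1) / 4, n]`. -/
theorem exists_mass_succ_le {β : ℝ} (hβ : 0 ≤ β) (hr : RegVarSeq β p)
    (hS : SmallTruncatedMean p) {δ : ℝ} (hδ : 0 < δ) :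
    ∃ C : ℝ, 0 < C ∧ ∀ᶠ n : ℕ in atTop, ∀ M : ℝ,
      (∀ j, n + 1 ≤ 4 * j → j ≤ n → a j ≤ M) →
        a (n + 1) ≤ C * (p (n + 1) * psum a (n + 1) ^ 2) + δ * M := by
  obtain ⟨L, hL4, hL⟩ := hS (δ / 4) (by linarith)
  obtain ⟨C, hC, N, hN⟩ := hr.exists_window hβ (L := L) (by omega)
  refine ⟨C, by linarith, ?_⟩
  filter_upwards [hL, eventually_ge_atTop (N + 4)] with n hn hnN M hM
  have hn0 : (0 : ℝ) < (n : ℝ) + 1 := by positivity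
  have hM0 : 0 ≤ M := (h.mass_nonneg n).trans (hM n (by omega) le_rfl)
  have hA0 : 0 ≤ psum a n := zero_le_one.trans (h.one_le_psum_mass n)
  have hpn := h.nonneg (n + 1)
  have hJ : n / L ≤ n / 4 := Nat.div_le_div_left hL4 (by norm_num)
  have hLn : L * (n / L) ≤ n := Nat.mul_div_le n L
  have hLn' : n < L * (n / L + 1) := Nat.lt_mul_div_succ n (by omega)
  generalize n / L = J at hn hJ hLn hLn'
  have hsmall : ∑ k ∈ Finset.range (J), ((k : ℝ) + 1) * p (k + 1) * conv a a (n - k) ≤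
      ((n : ℝ) + 1) * (δ * M) := by
    have h1 : ∀ k ∈ Finset.range (J), ((k : ℝ) + 1) * p (k + 1) * conv a a (n - k) ≤
        ((k : ℝ) + 1) * p (k + 1) * (2 * psum a n * M) := by
      intro k hk
      have hk' := Finset.mem_range.1 hk
      have h2 := conv_self_le h.mass_nonneg (n := n - k) (M := M)
        fun j hj hj' => hM j (by omega) (by omega)
      have h3 := psum_mono h.mass_nonneg (Nat.sub_le n k)
      have h4 := h.nonneg (k + 1)
      gcongr
      exact h2.trans (by gcongr)
    refine (Finset.sum_le_sum h1).trans ?_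
    rw [← Finset.sum_mul]
    calc _ ≤ δ / 4 * psum (tail p) n * (2 * psum a n * M) := by gcongr
      _ = δ / 2 * M * (psum (tail p) n * psum a n) := by ring
      _ ≤ δ / 2 * M * (2 * n + 1) := by
          gcongr
          exact h.psum_mass_mul_le n
      _ ≤ ((n : ℝ) + 1) * (δ * M) := by nlinarith [mul_nonneg hδ.le hM0]
  have hlarge : ∑ k ∈ Finset.range (n + 1 - J),
      (((J + k : ℕ) : ℝ) + 1) * p (J + k + 1) * conv a a (n - (J + k)) ≤
      ((n : ℝ) + 1) * (C * (p (n + 1) * psum a (n + 1) ^ 2)) := by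
    have h1 : ∀ k ∈ Finset.range (n + 1 - J),
        (((J + k : ℕ) : ℝ) + 1) * p (J + k + 1) * conv a a (n - (J + k)) ≤
        ((n : ℝ) + 1) * (C * p (n + 1)) * conv a a (n + 1 - J - 1 - k) := by
      intro k hk
      have hk' := Finset.mem_range.1 hk
      rw [show n - (J + k) = n + 1 - J - 1 - k by omega]
      have h2 := (hN (n + 1) (by omega) (J + k + 1)
        (by
          have : L * (J + 1) ≤ L * (J + k + 1) := Nat.mul_le_mul_left L (by omega)
          omega) (by omega)).2.1
      have h3 : ((J + k : ℕ) : ℝ) + 1 ≤ (n : ℝ) + 1 := by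
        have : J + k ≤ n := by omega
        have : ((J + k : ℕ) : ℝ) ≤ n := by exact_mod_cast this
        linarith
      have h4 := h.nonneg (J + k + 1)
      have h5 := h.conv_mass_nonneg (n + 1 - J - 1 - k)
      gcongr
    refine (Finset.sum_le_sum h1).trans ?_
    rw [← Finset.mul_sum, Finset.sum_range_reflect (conv a a)]
    have h2 : ∑ k ∈ Finset.range (n + 1 - J), conv a a k ≤ psum a (n + 1) ^ 2 := by
      calc _ ≤ psum (conv a a) n := Finset.sum_le_sum_of_subset_of_nonneg
            (Finset.range_mono (by omega)) fun k _ _ => h.conv_mass_nonneg k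
        _ ≤ psum a n * psum a n := psum_conv_le h.mass_nonneg h.mass_nonneg n
        _ = psum a n ^ 2 := (sq _).symm
        _ ≤ psum a (n + 1) ^ 2 := by
            have := psum_mono h.mass_nonneg (Nat.le_succ n)
            gcongr
    calc _ ≤ ((n : ℝ) + 1) * (C * p (n + 1)) * psum a (n + 1) ^ 2 := by gcongr
      _ = _ := by ring
  have h1 : ((n : ℝ) + 1) * a (n + 1) ≤
      ((n : ℝ) + 1) * (C * (p (n + 1) * psum a (n + 1) ^ 2) + δ * M) := by
    have hsplit := Finset.sum_range_add
      (fun k => ((k : ℝ) + 1) * p (k + 1) * conv a a (n - k)) (J) (n + 1 - J)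
    rw [Nat.add_sub_cancel' (by omega)] at hsplit
    rw [h.succ_mul_mass_succ, conv_eq_sum_range, mul_add, hsplit, add_comm]
    exact add_le_add hlarge hsmall
  exact le_of_mul_le_mul_left h1 hn0

/-- The upper bound `a n ≤ K p(n) (psum a n) ^ 2`, which matches the lower bound: the recursive
upper bound is a contraction. -/
theorem exists_mass_le {β : ℝ} (hβ : 0 ≤ β) (hr : RegVarSeq β p) (hS : SmallTruncatedMean p) :
    ∃ K : ℝ, 0 < K ∧ ∀ᶠ n : ℕ in atTop, a n ≤ K * (p n * psum a n ^ 2) := by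
  obtain ⟨C₁, hC₁, N₁, hN₁⟩ := hr.exists_window hβ (L := 4) (by norm_num)
  obtain ⟨C, hC, hrec⟩ := h.exists_mass_succ_le hβ hr hS (δ := 1 / (2 * C₁)) (by positivity)
  obtain ⟨N₂, hN₂⟩ := eventually_atTop.1 hrec
  set N := N₁ + N₂ + 1 with hNdef
  set w : ℕ → ℝ := fun n => p n * psum a n ^ 2 with hw
  have hw0 : ∀ n, 0 ≤ w n := fun n => mul_nonneg (h.nonneg n) (sq_nonneg _)
  have hwpos : ∀ n ≥ N, 0 < w n := fun n hn => by
    have h1 := (hN₁ n (by omega) n (by omega) le_rfl).1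
    have h2 := h.one_le_psum_mass n
    positivity
  -- The constant serves the initial stretch `[N, 4 N]` and dominates the recursion.
  set K := 2 * C + ∑ j ∈ Finset.range (4 * N + 1), (w j)⁻¹ with hK
  have hsum0 : 0 ≤ ∑ j ∈ Finset.range (4 * N + 1), (w j)⁻¹ :=
    Finset.sum_nonneg fun j _ => inv_nonneg.2 (hw0 j)
  have hK0 : 0 < K := by linarith
  refine ⟨K, hK0, eventually_atTop.2 ⟨N, fun n => ?_⟩⟩
  induction n using Nat.strong_induction_on with
  | _ n ih =>
    intro hn
    rcases Nat.lt_or_ge n (4 * N + 1) with hn4 | hn4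
    · have h1 : (w n)⁻¹ ≤ K := by
        have : (w n)⁻¹ ≤ ∑ j ∈ Finset.range (4 * N + 1), (w j)⁻¹ :=
          Finset.single_le_sum (f := fun j => (w j)⁻¹)
            (fun j _ => inv_nonneg.2 (hw0 j)) (Finset.mem_range.2 hn4)
        linarith
      have h2 := hwpos n hn
      calc a n ≤ 1 := h.mass_le_one n
        _ = (w n)⁻¹ * w n := (inv_mul_cancel₀ h2.ne').symm
        _ ≤ K * w n := by gcongr
    · obtain ⟨n, rfl⟩ : ∃ k, n = k + 1 := ⟨n - 1, by omega⟩
      have h1 := hN₂ n (by omega) (K * (C₁ * w (n + 1))) fun j hj hjn => by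
        have h2 := ih j (by omega) (by omega)
        have h3 := (hN₁ (n + 1) (by omega) j hj (by omega)).2.1
        have h4 := psum_mono h.mass_nonneg (show j ≤ n + 1 by omega)
        have h5 := psum_nonneg h.mass_nonneg j
        have h6 := h.nonneg (n + 1)
        refine h2.trans ?_
        have : p j * psum a j ^ 2 ≤ C₁ * w (n + 1) := by
          calc p j * psum a j ^ 2 ≤ C₁ * p (n + 1) * psum a (n + 1) ^ 2 := by gcongr
            _ = _ := by rw [hw]; ring
        gcongr
      have h2 : 1 / (2 * C₁) * (K * (C₁ * w (n + 1))) = K / 2 * w (n + 1) := by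
        field_simp
      rw [h2] at h1
      have h3 := hw0 (n + 1)
      have h4 : C ≤ K / 2 := by linarith
      calc a (n + 1) ≤ C * w (n + 1) + K / 2 * w (n + 1) := h1
        _ ≤ K / 2 * w (n + 1) + K / 2 * w (n + 1) := by gcongr
        _ = K * w (n + 1) := by ring

/-- The two bounds show that `a n` is of the order of `p(n) (psum a n) ^ 2`, which is doubling. -/
theorem doublingSeq_of_smallTruncatedMean {β : ℝ} (hβ : 0 ≤ β) (hr : RegVarSeq β p)
    (hS : SmallTruncatedMean p) : DoublingSeq a := by
  obtain ⟨C₁, hC₁, N₁, hN₁⟩ := hr.exists_window hβ (L := 4) (by norm_num)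
  obtain ⟨c, hc, hlow⟩ := h.exists_mul_sq_le_mass hβ hr
  obtain ⟨K, hK, hup⟩ := h.exists_mass_le hβ hr hS
  obtain ⟨N₂, hN₂⟩ := eventually_atTop.1 hlow
  obtain ⟨N₃, hN₃⟩ := eventually_atTop.1 hup
  refine ⟨K * (C₁ * c), 4 * (N₁ + N₂ + N₃ + 1), fun n hn => ⟨?_, fun m hm hmn => ?_⟩⟩
  · have h1 := (hN₁ n (by omega) n (by omega) le_rfl).1
    have h2 := h.one_le_psum_mass n
    have h3 := hN₂ n (by omega)
    have h4 : 0 < p n * psum a n ^ 2 := by positivity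
    exact pos_of_mul_pos_right (h4.trans_le h3) hc.le
  · have h1 := (hN₁ n (by omega) m hm hmn).2.1
    have h2 := psum_mono h.mass_nonneg hmn
    have h3 := psum_nonneg h.mass_nonneg m
    have h4 := h.nonneg n
    calc a m ≤ K * (p m * psum a m ^ 2) := hN₃ m (by omega)
      _ ≤ K * (C₁ * p n * psum a n ^ 2) := by gcongr
      _ = K * (C₁ * (p n * psum a n ^ 2)) := by ring
      _ ≤ K * (C₁ * (c * a n)) := by
        have := hN₂ n (by omega)
        gcongr
      _ = K * (C₁ * c) * a n := by ring

end RenewalPair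

/-! ### Ratios of consecutive values of the mass function -/

theorem RegVarSeq.tendsto_ratio {β : ℝ} {p : ℕ → ℝ} (hr : RegVarSeq β p) :
    Tendsto (fun n => p (n + 1) / p n) atTop (𝓝 1) := by
  have hbase : Tendsto (fun n : ℕ => ((n + 1 : ℕ) : ℝ) / n) atTop (𝓝 1) := by
    have h1 : Tendsto (fun n : ℕ => 1 + 1 / (n : ℝ)) atTop (𝓝 (1 + 0)) :=
      tendsto_const_nhds.add tendsto_one_div_atTop_nhds_zero_nat
    rw [add_zero] at h1
    refine h1.congr' ?_
    filter_upwards [eventually_ge_atTop 1] with n hn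
    have : (n : ℝ) ≠ 0 := by exact_mod_cast (show n ≠ 0 by omega)
    push_cast
    field_simp
  have hpow : ∀ c : ℝ, Tendsto (fun n : ℕ => (((n + 1 : ℕ) : ℝ) / n) ^ c) atTop (𝓝 1) := fun c => by
    have := hbase.rpow_const (p := c) (Or.inl one_ne_zero)
    rwa [Real.one_rpow] at this
  have hexp : Tendsto Real.exp (𝓝[>] 0) (𝓝 1) := by
    have := Real.continuous_exp.continuousAt.tendsto.mono_left
      (nhdsWithin_le_nhds (a := (0 : ℝ)) (s := Set.Ioi 0))
    rwa [Real.exp_zero] at this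
  have hup : ∀ b > (1 : ℝ), ∃ ε > 0, Real.exp ε < b := fun b hb =>
    ((hexp.eventually (gt_mem_nhds hb)).and self_mem_nhdsWithin).exists.imp fun ε h => ⟨h.2, h.1⟩
  have hpos : ∀ᶠ n in atTop, 0 < p n := by
    obtain ⟨N, -, hN⟩ := hr 1 one_pos
    filter_upwards [eventually_ge_atTop N] with n hn using (hN n n hn le_rfl).1
  have hpos' := (tendsto_add_atTop_nat 1).eventually hpos
  have h1 : ∀ b > (1 : ℝ), ∀ᶠ n in atTop, p (n + 1) < b * p n ∧ p n < b * p (n + 1) := by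
    intro b hb
    obtain ⟨ε, hε, hεb⟩ := hup b hb
    obtain ⟨N, hN1, hN⟩ := hr ε hε
    have e1 := (hpow (ε - β)).const_mul (Real.exp ε)
    have e2 := (hpow (ε + β)).const_mul (Real.exp ε)
    rw [mul_one] at e1 e2
    filter_upwards [e1.eventually (gt_mem_nhds hεb), e2.eventually (gt_mem_nhds hεb), hpos, hpos',
      eventually_ge_atTop N] with n h1 h2 h3 h4 h5
    obtain ⟨-, h6, h7⟩ := hN n (n + 1) h5 (by omega)
    exact ⟨h6.trans_lt (by gcongr), h7.trans_lt (by gcongr)⟩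
  rw [tendsto_order]
  constructor
  · intro b hb
    rcases le_or_gt b 0 with hb0 | hb0
    · filter_upwards [hpos, hpos'] with n h2 h3
      exact hb0.trans_lt (div_pos h3 h2)
    · filter_upwards [h1 b⁻¹ ((one_lt_inv₀ hb0).2 hb), hpos] with n h2 h3
      rw [lt_div_iff₀ h3]
      have := mul_lt_mul_of_pos_left h2.2 hb0
      rwa [← mul_assoc, mul_inv_cancel₀ hb0.ne', one_mul] at this
  · intro b hb
    filter_upwards [h1 b hb, hpos] with n h2 h3
    rw [div_lt_iff₀ h3]
    exact h2.1

namespace RenewalPair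

variable {p a : ℕ → ℝ} (h : RenewalPair p a)
include h

/-- As `psum a n = o(n)` when the mean is infinite, the doubling property gives
`(a * a) (n - k) = o(n a(n))`. -/
theorem eventually_conv_mass_le_of_doublingSeq (hd : DoublingSeq a)
    (hs : Tendsto (psum (tail p)) atTop atTop) {ε : ℝ} (hε : 0 < ε) (k : ℕ) :
    ∀ᶠ n : ℕ in atTop, conv a a (n - k) ≤ ε * (n * a n) := by
  obtain ⟨C, N, hN⟩ := hd
  filter_upwards [hs.eventually (eventually_ge_atTop (6 * C / ε)),
    eventually_ge_atTop (N + 2 * k + 1)] with n hn hnN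
  obtain ⟨han, hC⟩ := hN n (by omega)
  have hC1 : 1 ≤ C := by
    have := hC n (by omega) le_rfl
    by_contra hlt
    push Not at hlt
    nlinarith
  have h1 := conv_self_le h.mass_nonneg (n := n - k) (M := C * a n)
    fun j hj hj' => hC j (by omega) (by omega)
  have h2 := psum_mono h.mass_nonneg (Nat.sub_le n k)
  have hm : 0 < psum (tail p) n := zero_lt_one.trans_le (h.one_le_psum_tail n)
  have hn1 : (1 : ℝ) ≤ n := by exact_mod_cast (show 1 ≤ n by omega)
  have h3 : psum a n * (6 * C) ≤ 3 * n * ε := by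
    rw [div_le_iff₀ hε] at hn
    have h4 : psum a n * (6 * C) ≤ psum a n * (psum (tail p) n * ε) :=
      mul_le_mul_of_nonneg_left hn (psum_nonneg h.mass_nonneg n)
    have h5 := mul_le_mul_of_nonneg_right (h.psum_mass_mul_le n) hε.le
    nlinarith
  calc conv a a (n - k) ≤ 2 * psum a (n - k) * (C * a n) := h1
    _ ≤ 2 * psum a n * (C * a n) := by gcongr
    _ = psum a n * (6 * C) * (a n / 3) := by ring
    _ ≤ 3 * n * ε * (a n / 3) := by gcongr
    _ = ε * (n * a n) := by ring

/-- The increments of `n a(n)` are convolutions of `a * a` with the increments of `n p(n)`, which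
are small compared to `n p(n)` except for finitely many terms. -/
theorem tendsto_ratio_of_doublingSeq (hd : DoublingSeq a)
    (hs : Tendsto (psum (tail p)) atTop atTop) {β : ℝ} (hr : RegVarSeq β p) :
    Tendsto (fun n => a (n + 1) / a n) atTop (𝓝 1) := by
  set q : ℕ → ℝ := fun k => ((k : ℝ) + 1) * p (k + 1) with hq
  have hapos : ∀ᶠ n in atTop, 0 < a n := by
    obtain ⟨C, N, hN⟩ := hd
    filter_upwards [eventually_ge_atTop N] with n hn using (hN n hn).1
  have hnat : Tendsto (fun n : ℕ => ((n : ℝ) + 2) / (n + 1)) atTop (𝓝 1) := by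
    have h1 : Tendsto (fun n : ℕ => 1 + 1 / ((n : ℝ) + 1)) atTop (𝓝 (1 + 0)) :=
      tendsto_const_nhds.add tendsto_one_div_add_atTop_nhds_zero_nat
    rw [add_zero] at h1
    refine h1.congr fun n => ?_
    have : (n : ℝ) + 1 ≠ 0 := by positivity
    field_simp
    ring
  have hqr : Tendsto (fun k => q (k + 1) / q k) atTop (𝓝 1) := by
    have h1 := hnat.mul (hr.tendsto_ratio.comp (tendsto_add_atTop_nat 1))
    rw [one_mul] at h1
    refine h1.congr fun k => ?_
    simp only [hq, Function.comp]
    push_cast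
    rw [div_mul_div_comm]
    ring_nf
  have hqpos : ∀ᶠ k in atTop, 0 < q k := by
    obtain ⟨N, -, hN⟩ := hr 1 one_pos
    filter_upwards [eventually_ge_atTop N] with k hk
    have := (hN (k + 1) (k + 1) (by omega) le_rfl).1
    simp only [hq]
    positivity
  have hq0 : ∀ k, 0 ≤ q k := fun k => mul_nonneg (by positivity) (h.nonneg _)
  have hx : Tendsto (fun n : ℕ => (((n : ℝ) + 2) * a (n + 2)) / (((n : ℝ) + 1) * a (n + 1)))
      atTop (𝓝 1) := by
    rw [Metric.tendsto_nhds]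
    intro ε hε
    obtain ⟨K, hK⟩ := eventually_atTop.1 ((Metric.tendsto_nhds.1 hqr (ε / 4) (by linarith)).and
      hqpos)
    have hK' : ∀ k ≥ K, |q (k + 1) - q k| ≤ ε / 4 * q k := fun k hk => by
      obtain ⟨h1, h2⟩ := hK k hk
      rw [Real.dist_eq] at h1
      have e : q (k + 1) - q k = (q (k + 1) / q k - 1) * q k := by field_simp
      rw [e, abs_mul, abs_of_pos h2]
      gcongr
    set D := ∑ k ∈ Finset.range K, |q (k + 1) - q k| + q 0 with hD
    have hD0 : 0 ≤ D := add_nonneg (Finset.sum_nonneg fun k _ => abs_nonneg _) (hq0 0)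
    have hsmall : ∀ᶠ n : ℕ in atTop, ∀ k ∈ Finset.range K,
        conv a a (n + 1 - (k + 1)) ≤ ε / (4 * (D + 1)) * ((n + 1 : ℕ) * a (n + 1)) := by
      rw [eventually_all_finset]
      exact fun k _ => (tendsto_add_atTop_nat 1).eventually
        (h.eventually_conv_mass_le_of_doublingSeq hd hs (by positivity) (k + 1))
    have hsmall0 : ∀ᶠ n : ℕ in atTop,
        conv a a (n + 1) ≤ ε / (4 * (D + 1)) * ((n + 1 : ℕ) * a (n + 1)) :=
      (tendsto_add_atTop_nat 1).eventually
        (h.eventually_conv_mass_le_of_doublingSeq hd hs (by positivity) 0)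
    filter_upwards [hsmall, hsmall0, (tendsto_add_atTop_nat 1).eventually hapos,
      eventually_ge_atTop K] with n hn hn0 han hnK
    push_cast at hn hn0
    set X := ((n : ℝ) + 1) * a (n + 1) with hX
    have hX0 : 0 < X := by positivity
    have hXq : X = ∑ k ∈ Finset.range (n + 1), q k * conv a a (n - k) := by
      rw [hX, h.succ_mul_mass_succ, conv_eq_sum_range]
    have hY : ((n : ℝ) + 2) * a (n + 2) =
        ∑ k ∈ Finset.range (n + 1), q (k + 1) * conv a a (n - k) + q 0 * conv a a (n + 1) := by
      have := h.succ_mul_mass_succ (n + 1)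
      rw [conv_eq_sum_range, Finset.sum_range_succ'] at this
      push_cast at this
      rw [show (n : ℝ) + 2 = n + 1 + 1 by ring, this]
      simp [hq]
    have hsplit : ∀ f : ℕ → ℝ, ∑ k ∈ Finset.range (n + 1), f k =
        ∑ k ∈ Finset.range K, f k + ∑ k ∈ Finset.range (n + 1 - K), f (K + k) := fun f => by
      rw [← Finset.sum_range_add, Nat.add_sub_cancel' (by omega)]
    have h1 : |∑ k ∈ Finset.range K, (q (k + 1) - q k) * conv a a (n - k)| ≤
        (∑ k ∈ Finset.range K, |q (k + 1) - q k|) * (ε / (4 * (D + 1)) * X) := by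
      rw [Finset.sum_mul]
      refine (Finset.abs_sum_le_sum_abs _ _).trans (Finset.sum_le_sum fun k hk => ?_)
      rw [abs_mul, abs_of_nonneg (h.conv_mass_nonneg _)]
      have := hn k hk
      gcongr
    have h2 : |∑ k ∈ Finset.range (n + 1 - K),
        (q (K + k + 1) - q (K + k)) * conv a a (n - (K + k))| ≤ ε / 4 * X := by
      have h3 : ∑ k ∈ Finset.range (n + 1 - K), q (K + k) * conv a a (n - (K + k)) ≤ X := by
        rw [hXq, hsplit]
        exact le_add_of_nonneg_left (Finset.sum_nonneg fun k _ =>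
          mul_nonneg (hq0 k) (h.conv_mass_nonneg _))
      refine (Finset.abs_sum_le_sum_abs _ _).trans (le_trans ?_
        (mul_le_mul_of_nonneg_left h3 (by linarith)))
      rw [Finset.mul_sum]
      refine Finset.sum_le_sum fun k hk => ?_
      rw [abs_mul, abs_of_nonneg (h.conv_mass_nonneg _), ← mul_assoc]
      exact mul_le_mul_of_nonneg_right (hK' _ (by omega)) (h.conv_mass_nonneg _)
    have h3 : |q 0 * conv a a (n + 1)| ≤ q 0 * (ε / (4 * (D + 1)) * X) := by
      rw [abs_of_nonneg (mul_nonneg (hq0 0) (h.conv_mass_nonneg _))]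
      exact mul_le_mul_of_nonneg_left hn0 (hq0 0)
    have hdiff : ((n : ℝ) + 2) * a (n + 2) - X =
        ∑ k ∈ Finset.range K, (q (k + 1) - q k) * conv a a (n - k) +
        ∑ k ∈ Finset.range (n + 1 - K), (q (K + k + 1) - q (K + k)) * conv a a (n - (K + k)) +
        q 0 * conv a a (n + 1) := by
      rw [hY, hXq, ← hsplit (fun k => (q (k + 1) - q k) * conv a a (n - k))]
      simp only [sub_mul, Finset.sum_sub_distrib]
      ring
    have h4 : D * (ε / (4 * (D + 1)) * X) ≤ ε / 4 * X := by
      calc D * (ε / (4 * (D + 1)) * X) ≤ (D + 1) * (ε / (4 * (D + 1)) * X) := by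
            gcongr; linarith
        _ = ε / 4 * X := by field_simp
    have h5 : |((n : ℝ) + 2) * a (n + 2) - X| ≤ ε / 2 * X := by
      rw [hdiff]
      refine (abs_add_three _ _ _).trans ?_
      rw [hD] at h4
      linarith
    rw [Real.dist_eq, div_sub_one hX0.ne', abs_div, abs_of_pos hX0, div_lt_iff₀ hX0]
    nlinarith
  have h1 : Tendsto (fun n => a (n + 2) / a (n + 1)) atTop (𝓝 1) := by
    have h2 := hx.div hnat one_ne_zero
    rw [div_one] at h2
    refine h2.congr fun n => ?_
    have e1 : (n : ℝ) + 1 ≠ 0 := by positivity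
    have e2 : (n : ℝ) + 2 ≠ 0 := by positivity
    simp only [Pi.div_apply]
    rw [mul_div_mul_comm, mul_div_cancel_left₀ _ (div_ne_zero e2 e1)]
  exact (tendsto_add_atTop_iff_nat (f := fun n => a (n + 1) / a n) 1).1 h1

/-- The two properties of the mass function on which the asymptotics of the intersection rest. -/
theorem doublingSeq_and_tendsto_ratio {α : ℝ} (hα : 0 ≤ α) (hr : RegVarSeq (1 + α) p) :
    DoublingSeq a ∧ Tendsto (fun n => a (n + 1) / a n) atTop (𝓝 1) := by
  obtain ⟨N, -, hN⟩ := hr 1 one_pos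
  have hpos : ∀ k ≥ N, 0 < p k := fun k hk => (hN k k hk le_rfl).1
  have hsum : Tendsto (tail p) atTop (𝓝 0) → HasSum p 1 := fun ht => by
    rw [hasSum_iff_tendsto_nat_of_nonneg h.nonneg, ← tendsto_add_atTop_iff_nat 1]
    have := ht.const_sub 1
    rw [sub_zero] at this
    exact this.congr fun n => by simp [tail, psum]
  -- The sums of the tails diverge exactly when the mean is infinite.
  rcases tendsto_atTop_of_monotone (psum_mono h.tail_nonneg) with hs | ⟨l, hl⟩
  · have hd : DoublingSeq a := by
      obtain ⟨ρ, hρ⟩ : ∃ ρ, Tendsto (tail p) atTop (𝓝 ρ) :=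
        ⟨_, tendsto_atTop_ciInf h.tail_antitone ⟨0, by rintro _ ⟨n, rfl⟩; exact h.tail_nonneg n⟩⟩
      have hle := h.tail_antitone.le_of_tendsto hρ
      rcases (ge_of_tendsto' hρ h.tail_nonneg).eq_or_lt' with h0 | h0
      · subst h0
        rcases hα.eq_or_lt' with rfl | hα
        · rw [add_zero] at hr
          exact h.doublingSeq_of_smallTruncatedMean zero_le_one hr
            (h.smallTruncatedMean_of_regVarSeq_one hr hs)
        · exact h.doublingSeq_of_recurrent hα hr (hsum hρ) hs
      · exact h.doublingSeq_of_smallTruncatedMean (by linarith) hr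
          (h.smallTruncatedMean_of_transient h0 hle)
    exact ⟨hd, h.tendsto_ratio_of_doublingSeq hd hs hr⟩
  · have hsm : Summable (tail p) := by
      refine summable_of_sum_range_le (c := l) h.tail_nonneg fun n => ?_
      refine le_trans ?_ ((psum_mono h.tail_nonneg).ge_of_tendsto hl n)
      exact Finset.sum_le_sum_of_subset_of_nonneg (Finset.range_mono (by omega))
        fun k _ _ => h.tail_nonneg k
    have hlim := h.tendsto_mass_of_summable (hsum hsm.tendsto_atTop_zero) hpos hsm
    have hc : 0 < (∑' k, tail p k)⁻¹ := by
      refine inv_pos.2 (zero_lt_one.trans_le ?_)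
      rw [← h.tail_zero]
      exact hsm.le_tsum 0 fun k _ => h.tail_nonneg k
    refine ⟨h.doublingSeq_of_tendsto hc hlim, ?_⟩
    have := (hlim.comp (tendsto_add_atTop_nat 1)).div hlim hc.ne'
    rwa [div_self hc.ne'] at this

end RenewalPair

/-! ### From the mass function back to the first return -/

theorem tendsto_conv_of_summable {x y : ℕ → ℝ} (hx0 : ∀ n, 0 ≤ x n) (hx : Summable x) {B l : ℝ}
    (hy : ∀ n, |y n| ≤ B) (hl : Tendsto y atTop (𝓝 l)) :
    Tendsto (conv x y) atTop (𝓝 ((∑' k, x k) * l)) := by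
  have hB : 0 ≤ B := (abs_nonneg _).trans (hy 0)
  rw [← tsum_mul_right]
  refine (tendsto_tsum_of_dominated_convergence (hx.mul_right B) (fun k => ?_)
    (Eventually.of_forall fun n k => ?_)).congr fun n => (RenewalPair.conv_eq_tsum x y n).symm
  · refine ((hl.comp (tendsto_sub_atTop_nat k)).const_mul (x k)).congr' ?_
    filter_upwards [eventually_ge_atTop k] with n hn
    simp [hn]
  · rw [norm_mul, Real.norm_eq_abs, abs_of_nonneg (hx0 k)]
    refine mul_le_mul_of_nonneg_left ?_ (hx0 k)
    split_ifs
    exacts [hy _, by simpa using hB]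

theorem tendsto_sub_div_of_tendsto_ratio {u : ℕ → ℝ} (hpos : ∀ᶠ n in atTop, 0 < u n)
    (hr : Tendsto (fun n => u (n + 1) / u n) atTop (𝓝 1)) (k : ℕ) :
    Tendsto (fun n => u (n - k) / u n) atTop (𝓝 1) := by
  induction k with
  | zero =>
    refine tendsto_const_nhds.congr' ?_
    filter_upwards [hpos] with n hn
    simp [hn.ne']
  | succ k ih =>
    have h1 := (hr.comp (tendsto_sub_atTop_nat (k + 1))).inv₀ one_ne_zero
    have h2 := h1.mul ih
    rw [inv_one, one_mul] at h2
    refine h2.congr' ?_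
    filter_upwards [eventually_ge_atTop (k + 1), (tendsto_sub_atTop_nat k).eventually hpos]
      with n hn hk
    simp only [Function.comp, inv_div]
    rw [show n - (k + 1) + 1 = n - k by omega, div_mul_div_cancel₀ hk.ne']

namespace RenewalPair

variable {f u : ℕ → ℝ} (h : RenewalPair f u)
include h

/-- A transient renewal process has finitely many renewals on average. -/
theorem summable_mass {ρ : ℝ} (hρ : 0 < ρ) (ht : ∀ n, ρ ≤ tail f n) : Summable u := by
  refine summable_of_sum_range_le (c := 2 / ρ) h.mass_nonneg fun n => ?_
  have h1 : ((n : ℝ) + 1) * ρ ≤ psum (tail f) n := by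
    have := Finset.card_nsmul_le_sum (Finset.range (n + 1)) (tail f) ρ fun k _ => ht k
    simpa [psum] using this
  have h2 := h.psum_mass_mul_le n
  have h3 := psum_nonneg h.mass_nonneg n
  have h4 : psum u n ≤ 2 / ρ := by
    rw [le_div_iff₀ hρ]
    have hn : (0 : ℝ) < (n : ℝ) + 1 := by positivity
    have h5 := mul_le_mul_of_nonneg_right h1 h3
    have : ((n : ℝ) + 1) * (psum u n * ρ) ≤ ((n : ℝ) + 1) * 2 := by nlinarith
    exact le_of_mul_le_mul_left this hn
  refine le_trans ?_ h4
  exact Finset.sum_le_sum_of_subset_of_nonneg (Finset.range_mono (by omega))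
    fun k _ _ => h.mass_nonneg k

theorem summable_law : Summable f := by
  refine summable_of_sum_range_le (c := 1) h.nonneg fun n => le_trans ?_ (h.psum_le n)
  exact Finset.sum_le_sum_of_subset_of_nonneg (Finset.range_mono (by omega))
    fun k _ _ => h.nonneg k

theorem tsum_mass_mul (hu : Summable u) : (∑' n, u n) * (1 - ∑' n, f n) = 1 := by
  have h1 : (∑' n, f n) * ∑' n, u n = ∑' n, conv f u n :=
    h.summable_law.tsum_mul_tsum_eq_tsum_sum_antidiagonal hu
      (summable_mul_of_summable_norm h.summable_law.norm hu.norm)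
  have h2 : ∑' n, u n = 1 + ∑' n, conv f u n := by
    have h3 : Summable (conv f u) := by
      rw [← summable_nat_add_iff 1]
      exact ((summable_nat_add_iff 1).2 hu).congr fun n => h.mass_eq (by omega)
    rw [hu.tsum_eq_zero_add, h3.tsum_eq_zero_add, h.mass_zero]
    have h4 : conv f u 0 = 0 := by simp [conv_eq_sum_range, h.zero]
    rw [h4, zero_add]
    congr 1
    exact tsum_congr fun n => h.mass_eq (by omega)
  rw [← h1] at h2
  linear_combination h2

theorem law_le_mass (n : ℕ) : f n ≤ u n := by
  rcases Nat.eq_zero_or_pos n with rfl | hn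
  · rw [h.zero]; exact h.mass_nonneg 0
  · rw [h.mass_eq hn, conv_eq_sum_range, Finset.sum_range_succ, Nat.sub_self, h.mass_zero, mul_one]
    exact le_add_of_nonneg_left (Finset.sum_nonneg fun k _ =>
      mul_nonneg (h.nonneg k) (h.mass_nonneg _))

/-- For a summable mass function `u` whose ratios tend to `1` and which is doubling, the first
return satisfies `f ~ u / (∑ u) ^ 2`. With `g = f / u`, the renewal equation split at `n / 2` says
that `u * g` tends to `1 - ∑ f = 1 / ∑ u`, and `g` is recovered as `(1 - f) * (u * g)`. -/
theorem tendsto_law_div_mass (hu : Summable u) (hd : DoublingSeq u)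
    (hr : Tendsto (fun n => u (n + 1) / u n) atTop (𝓝 1)) :
    Tendsto (fun n => f n / u n) atTop (𝓝 (1 / (∑' n, u n) ^ 2)) := by
  obtain ⟨C, N, hN⟩ := hd
  have hpos : ∀ᶠ n in atTop, 0 < u n := by
    filter_upwards [eventually_ge_atTop N] with n hn using (hN n hn).1
  have hshift := tendsto_sub_div_of_tendsto_ratio hpos hr
  set g : ℕ → ℝ := fun n => f n / u n with hg
  have hgu : ∀ n, g n * u n = f n := fun n => by
    rcases (h.mass_nonneg n).eq_or_lt' with h0 | h0
    · have := h.law_le_mass n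
      rw [h0, mul_zero]
      linarith [h.nonneg n]
    · simp only [hg]; field_simp
  have hg0 : ∀ n, 0 ≤ g n := fun n => div_nonneg (h.nonneg n) (h.mass_nonneg n)
  have hg1 : ∀ n, g n ≤ 1 := fun n => div_le_one_of_le₀ (h.law_le_mass n) (h.mass_nonneg n)
  have hratio : ∀ n ≥ N, ∀ m, n ≤ 4 * m → m ≤ n → 0 ≤ u m / u n ∧ u m / u n ≤ C :=
    fun n hn m hm hmn => by
      obtain ⟨h1, h2⟩ := hN n hn
      exact ⟨div_nonneg (h.mass_nonneg m) h1.le, (div_le_iff₀ h1).2 (h2 m hm hmn)⟩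
  have hC0 : 0 ≤ C := (hratio N le_rfl N (by omega) le_rfl).1.trans
    (hratio N le_rfl N (by omega) le_rfl).2
  -- The part `k ≤ n / 2` of the renewal equation, divided by `u n`.
  have hS1 : Tendsto (fun n => ∑' k, f k * (if 2 * k ≤ n then u (n - k) / u n else 0)) atTop
      (𝓝 (∑' k, f k * 1)) := by
    refine tendsto_tsum_of_dominated_convergence (h.summable_law.mul_right C) (fun k => ?_) ?_
    · refine ((hshift k).const_mul (f k)).congr' ?_
      filter_upwards [eventually_ge_atTop (2 * k)] with n hn
      simp [hn]
    · filter_upwards [eventually_ge_atTop N] with n hn k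
      rw [norm_mul, Real.norm_eq_abs, abs_of_nonneg (h.nonneg k)]
      refine mul_le_mul_of_nonneg_left ?_ (h.nonneg k)
      split_ifs with hk
      · obtain ⟨h1, h2⟩ := hratio n hn (n - k) (by omega) (by omega)
        rwa [Real.norm_eq_abs, abs_of_nonneg h1]
      · simpa using hC0
  -- The part `k > n / 2`, with `j = n - k` and `f = g * u`, differs little from `conv u g n`.
  have hS2 : Tendsto (fun n => ∑' j, u j * ((if j ≤ n then g (n - j) else 0) -
      (if 2 * j < n then g (n - j) * (u (n - j) / u n) else 0))) atTop (𝓝 (∑' j, u j * 0)) := by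
    refine tendsto_tsum_of_dominated_convergence (hu.mul_right (1 + C)) (fun j => ?_) ?_
    · refine Tendsto.const_mul (u j) ?_
      have h1 : Tendsto (fun n => 1 - u (n - j) / u n) atTop (𝓝 0) := by
        simpa using (hshift j).const_sub 1
      refine squeeze_zero_norm' ?_ (tendsto_zero_iff_abs_tendsto_zero _ |>.1 h1)
      filter_upwards [eventually_ge_atTop (2 * j + 1)] with n hn
      rw [if_pos (by omega), if_pos (by omega), ← mul_one_sub, norm_mul, Real.norm_eq_abs,
        Real.norm_eq_abs, abs_of_nonneg (hg0 _)]
      exact mul_le_of_le_one_left (abs_nonneg _) (hg1 _)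
    · filter_upwards [eventually_ge_atTop N] with n hn j
      rw [norm_mul, Real.norm_eq_abs, abs_of_nonneg (h.mass_nonneg j)]
      refine mul_le_mul_of_nonneg_left ((norm_sub_le _ _).trans (add_le_add ?_ ?_))
        (h.mass_nonneg j)
      · split_ifs
        · rw [Real.norm_eq_abs, abs_of_nonneg (hg0 _)]; exact hg1 _
        · simp
      · split_ifs with hj
        · obtain ⟨h1, h2⟩ := hratio n hn (n - j) (by omega) (by omega)
          rw [norm_mul, Real.norm_eq_abs, Real.norm_eq_abs, abs_of_nonneg (hg0 _),
            abs_of_nonneg h1]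
          exact (mul_le_of_le_one_left h1 (hg1 _)).trans h2
        · simpa using hC0
  have hug : Tendsto (conv u g) atTop (𝓝 (1 - ∑' k, f k)) := by
    have h1 := (hS2.add (hS1.const_sub 1))
    simp only [mul_zero, tsum_zero, zero_add, mul_one] at h1
    refine h1.congr' ?_
    filter_upwards [hpos, eventually_ge_atTop 1] with n hn hn1
    have e1 : ∑' k, f k * (if 2 * k ≤ n then u (n - k) / u n else 0) =
        ∑ k ∈ Finset.range (n + 1), f k * (if 2 * k ≤ n then u (n - k) / u n else 0) := by
      refine tsum_eq_sum fun k hk => ?_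
      rw [if_neg (by have := Finset.mem_range.not.1 hk; omega), mul_zero]
    have e2 : ∑' j, u j * ((if j ≤ n then g (n - j) else 0) -
        (if 2 * j < n then g (n - j) * (u (n - j) / u n) else 0)) =
        ∑ j ∈ Finset.range (n + 1), u j * ((if j ≤ n then g (n - j) else 0) -
        (if 2 * j < n then g (n - j) * (u (n - j) / u n) else 0)) := by
      refine tsum_eq_sum fun k hk => ?_
      have := Finset.mem_range.not.1 hk
      rw [if_neg (by omega), if_neg (by omega), sub_zero, mul_zero]
    have e3 : ∑ j ∈ Finset.range (n + 1), u j * (if 2 * j < n then g (n - j) * (u (n - j) / u n)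
        else 0) = ∑ k ∈ Finset.range (n + 1), f k * (if n < 2 * k then u (n - k) / u n else 0) := by
      rw [← Finset.sum_range_reflect]
      refine Finset.sum_congr rfl fun k hk => ?_
      have hk' := Finset.mem_range.1 hk
      rw [show n + 1 - 1 - k = n - k by omega, show n - (n - k) = k by omega]
      by_cases hkn : n < 2 * k
      · rw [if_pos (by omega), if_pos hkn, ← hgu k]; ring
      · rw [if_neg (by omega), if_neg hkn, mul_zero, mul_zero]
    have e4 : ∑ k ∈ Finset.range (n + 1), f k * (if n < 2 * k then u (n - k) / u n else 0) +
        ∑ k ∈ Finset.range (n + 1), f k * (if 2 * k ≤ n then u (n - k) / u n else 0) = 1 := by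
      rw [← Finset.sum_add_distrib]
      have h2 := h.mass_eq hn1
      rw [conv_eq_sum_range] at h2
      rw [← div_self hn.ne']
      nth_rewrite 3 [h2]
      rw [Finset.sum_div]
      refine Finset.sum_congr rfl fun k _ => ?_
      by_cases hkn : n < 2 * k
      · rw [if_pos hkn, if_neg (by omega)]; ring
      · rw [if_neg hkn, if_pos (by omega)]; ring
    have e5 : ∑ j ∈ Finset.range (n + 1), u j * (if j ≤ n then g (n - j) else 0) = conv u g n := by
      rw [conv_eq_sum_range]
      exact Finset.sum_congr rfl fun j hj => by
        rw [if_pos (by have := Finset.mem_range.1 hj; omega)]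
    rw [e1, e2]
    simp only [mul_sub, Finset.sum_sub_distrib]
    rw [e5, e3]
    linarith
  have hbd : ∀ n, |conv u g n| ≤ ∑' k, u k := fun n => by
    rw [abs_of_nonneg (conv_nonneg h.mass_nonneg hg0 n), conv_eq_sum_range]
    refine le_trans (Finset.sum_le_sum fun k _ => mul_le_of_le_one_right (h.mass_nonneg k) (hg1 _))
      (hu.sum_le_tsum _ fun k _ => h.mass_nonneg k)
  have hfin := hug.sub (tendsto_conv_of_summable h.nonneg h.summable_law hbd hug)
  have hge : ∀ n, conv u g n - conv f (conv u g) n = g n := fun n => by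
    have : PowerSeries.mk (fun n => conv u g n - conv f (conv u g) n) = PowerSeries.mk g := by
      have e : PowerSeries.mk (fun n => conv u g n - conv f (conv u g) n) =
          PowerSeries.mk (conv u g) - PowerSeries.mk (conv f (conv u g)) := by
        ext n; simp
      rw [e, mk_conv, mk_conv, mk_conv]
      linear_combination (PowerSeries.mk g) * h.mul_eq
    exact congrFun (eq_of_mk_eq this) n
  simp only [hge] at hfin
  have hU := h.tsum_mass_mul hu
  convert hfin using 2
  have hU0 : ∑' n, u n ≠ 0 := left_ne_zero_of_mul_eq_one hU
  rw [eq_comm, ← one_sub_mul, eq_div_iff (pow_ne_zero 2 hU0)]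
  calc _ = ((∑' n, u n) * (1 - ∑' n, f n)) ^ 2 := by ring
    _ = 1 := by rw [hU, one_pow]

end RenewalPair

theorem DoublingSeq.mul {a b : ℕ → ℝ} (ha : DoublingSeq a) (hb : DoublingSeq b)
    (ha0 : ∀ n, 0 ≤ a n) (hb0 : ∀ n, 0 ≤ b n) : DoublingSeq fun n => a n * b n := by
  obtain ⟨C, N, h⟩ := ha
  obtain ⟨C', N', h'⟩ := hb
  refine ⟨C * C', max N N', fun n hn => ?_⟩
  obtain ⟨h1, h2⟩ := h n ((le_max_left _ _).trans hn)
  obtain ⟨h3, h4⟩ := h' n ((le_max_right _ _).trans hn)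
  refine ⟨mul_pos h1 h3, fun m hm hmn => ?_⟩
  calc a m * b m ≤ (C * a n) * (C' * b n) :=
        mul_le_mul (h2 m hm hmn) (h4 m hm hmn) (hb0 m) ((ha0 m).trans (h2 m hm hmn))
    _ = C * C' * (a n * b n) := by ring

/-! ### Renewal sets -/

section Renewal

variable {Ω : Type*}

theorem renewalTime_add (ξ : ℕ → Ω → ℕ∞) (i l : ℕ) (ω : Ω) :
    renewalTime ξ (i + l) ω = renewalTime ξ i ω + renewalTime (fun j => ξ (i + j)) l ω :=
  Finset.sum_range_add _ _ _

theorem renewalTime_mono (ξ : ℕ → Ω → ℕ∞) (ω : Ω) : Monotone fun i => renewalTime ξ i ω :=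
  fun _ _ hij => Finset.sum_le_sum_of_subset (Finset.range_mono hij)

theorem renewalTime_lt {ξ : ℕ → Ω → ℕ∞} {ω : Ω} (hpos : ∀ i, 1 ≤ ξ i ω) {i l k : ℕ} (hil : i < l)
    (hk : renewalTime ξ i ω = k) : (k : ℕ∞) < renewalTime ξ l ω := by
  have h1 : renewalTime ξ (i + 1) ω ≤ renewalTime ξ l ω := renewalTime_mono ξ ω hil
  have h2 : (k : ℕ∞) + 1 ≤ renewalTime ξ (i + 1) ω := by
    rw [renewalTime, Finset.sum_range_succ, ← renewalTime, hk]
    exact add_le_add_right (hpos i) _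
  exact (ENat.add_one_le_iff (ENat.natCast_ne_top k)).1 (h2.trans h1)

/-- After a renewal at `k`, the renewals from `k` on are those of the shifted process. -/
theorem mem_renewalSet_iff_of_renewalTime_eq {ξ : ℕ → Ω → ℕ∞} {ω : Ω} (hpos : ∀ i, 1 ≤ ξ i ω)
    {i k n : ℕ} (hk : renewalTime ξ i ω = k) (hkn : k ≤ n) :
    n ∈ renewalSet ξ ω ↔ n - k ∈ renewalSet (fun j => ξ (i + j)) ω := by
  have hn : (n : ℕ∞) = k + (n - k : ℕ) := by exact_mod_cast (Nat.add_sub_cancel' hkn).symm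
  constructor
  · rintro ⟨l, hl⟩
    have hil : i ≤ l := by
      by_contra! hlt
      have := renewalTime_lt hpos hlt hl
      rw [hk] at this
      exact absurd (by exact_mod_cast this) (not_lt.2 hkn)
    refine ⟨l - i, ?_⟩
    have h1 := renewalTime_add ξ i (l - i) ω
    rw [Nat.add_sub_cancel' hil, hl, hk, hn] at h1
    exact (ENat.add_right_injective_of_ne_top (ENat.natCast_ne_top k) h1).symm
  · rintro ⟨l, hl⟩
    exact ⟨i + l, by rw [renewalTime_add, hk, hl, ← hn]⟩

theorem mem_renewalSet_iff_exists_le {ξ : ℕ → Ω → ℕ∞} {ω : Ω} (hpos : ∀ i, 1 ≤ ξ i ω)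
    {i k m : ℕ} (hk : renewalTime ξ i ω = k) (hmk : m ≤ k) :
    m ∈ renewalSet ξ ω ↔ ∃ l ≤ i, renewalTime ξ l ω = m := by
  refine ⟨fun ⟨l, hl⟩ => ⟨l, ?_, hl⟩, fun ⟨l, _, hl⟩ => ⟨l, hl⟩⟩
  by_contra! hlt
  have := renewalTime_lt hpos hlt hk
  rw [hl] at this
  exact absurd (by exact_mod_cast this) (not_lt.2 hmk)

theorem zero_mem_renewalSet (ξ : ℕ → Ω → ℕ∞) (ω : Ω) : 0 ∈ renewalSet ξ ω :=
  ⟨0, by simp [renewalTime]⟩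

theorem firstPoint_le {A : Ω → Set ℕ} {ω : Ω} {n : ℕ} (hn : n ∈ A ω) (hn0 : 0 < n) :
    firstPoint A ω ≤ n := iInf₂_le (f := fun (n : ℕ) _ => (n : ℕ∞)) n ⟨hn, hn0⟩

theorem firstPoint_eq_coe_iff {A : Ω → Set ℕ} {ω : Ω} {k : ℕ} :
    firstPoint A ω = k ↔ k ∈ A ω ∧ 0 < k ∧ ∀ j, 0 < j → j < k → j ∉ A ω := by
  constructor
  · intro h
    have hlow : ∀ j, 0 < j → j ∈ A ω → k ≤ j := fun j hj hjA => by
      have := firstPoint_le hjA hj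
      rw [h] at this
      exact_mod_cast this
    have hk : k ∈ A ω ∧ 0 < k := by
      by_contra hcon
      have : ((k + 1 : ℕ) : ℕ∞) ≤ firstPoint A ω := le_iInf₂ fun j hj => by
        have h1 := hlow j hj.2 hj.1
        have h2 : j ≠ k := fun e => hcon (e ▸ hj)
        exact_mod_cast (show k + 1 ≤ j by omega)
      rw [h] at this
      have : k + 1 ≤ k := by exact_mod_cast this
      omega
    exact ⟨hk.1, hk.2, fun j hj hjk hjA => absurd (hlow j hj hjA) (by omega)⟩
  · rintro ⟨h1, h2, h3⟩
    refine le_antisymm (firstPoint_le h1 h2) (le_iInf₂ fun j hj => ?_)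
    by_contra! hlt
    exact h3 j hj.2 (by exact_mod_cast hlt) hj.1

variable [MeasurableSpace Ω]

theorem measurable_renewalTime {ξ : ℕ → Ω → ℕ∞} {k : ℕ} (hξ : ∀ i < k, Measurable (ξ i)) :
    Measurable (renewalTime ξ k) := by
  unfold renewalTime
  exact Finset.measurable_sum _ fun i hi => hξ i (Finset.mem_range.1 hi)

theorem measurableSet_renewalTime_eq {ξ : ℕ → Ω → ℕ∞} {k : ℕ} (hξ : ∀ i < k, Measurable (ξ i))
    (n : ℕ) : MeasurableSet {ω | renewalTime ξ k ω = n} :=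
  measurable_renewalTime hξ (measurableSet_singleton _)

theorem measurableSet_mem_renewalSet {ξ : ℕ → Ω → ℕ∞} (hξ : ∀ i, Measurable (ξ i)) (n : ℕ) :
    MeasurableSet {ω | n ∈ renewalSet ξ ω} := by
  have : {ω | n ∈ renewalSet ξ ω} = ⋃ k, {ω | renewalTime ξ k ω = n} := by
    ext ω; simp [renewalSet]
  rw [this]
  exact MeasurableSet.iUnion fun k => measurableSet_renewalTime_eq (fun i _ => hξ i) n

/-- The event that the points of the random set `A` in `[0, k]` are those of `S`. -/
def traceEvent (A : Ω → Set ℕ) (k : ℕ) (S : Finset ℕ) : Set Ω :=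
  {ω | ∀ m ≤ k, m ∈ S ↔ m ∈ A ω}

theorem measurableSet_traceEvent {A : Ω → Set ℕ} (hA : ∀ n, MeasurableSet {ω | n ∈ A ω}) (k : ℕ)
    (S : Finset ℕ) : MeasurableSet (traceEvent A k S) := by
  have : traceEvent A k S = ⋂ m, ⋂ (_ : m ≤ k), {ω | m ∈ S ↔ m ∈ A ω} := by
    ext ω; simp [traceEvent]
  rw [this]
  refine MeasurableSet.iInter fun m => MeasurableSet.iInter fun _ => ?_
  by_cases hm : m ∈ S
  · simpa [hm] using hA m
  · convert (hA m).compl using 1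
    ext ω; simp [hm]

namespace IsInterarrival

variable {P : Measure Ω} {ξ : ℕ → Ω → ℕ∞} (h : IsInterarrival ξ P)
include h

theorem measure_compl_pos : P {ω | ∀ i, 1 ≤ ξ i ω}ᶜ = 0 := by
  have : ∀ᵐ ω ∂P, ∀ i, 1 ≤ ξ i ω := ae_all_iff.2 h.pos
  exact mem_ae_iff.1 this

theorem measurableSet_pos : MeasurableSet {ω | ∀ i, 1 ≤ ξ i ω} := by
  rw [Set.ofPred_forall]
  exact MeasurableSet.iInter fun i => h.measurable i (MeasurableSet.of_discrete (s := Set.Ici 1))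

theorem measure_shift (i n : ℕ) :
    P {ω | n ∈ renewalSet (fun j => ξ (i + j)) ω} = P {ω | n ∈ renewalSet ξ ω} := by
  have hid : IdentDistrib (fun ω j => ξ (i + j) ω) (fun ω j => ξ j ω) P P :=
    IdentDistrib.pi (fun j => (h.identDistrib (i + j)).trans (h.identDistrib j).symm)
      (h.indep.precomp (add_right_injective i)) h.indep
  exact hid.measure_mem_eq (measurableSet_mem_renewalSet
    (ξ := fun j (x : ℕ → ℕ∞) => x j) (fun j => measurable_pi_apply j) n)

/-- The Markov property at the `i`-th renewal. -/
theorem measure_inter_shift {i : ℕ} {E : Set Ω}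
    (hE : MeasurableSet[⨆ j ∈ Set.Iio i, MeasurableSpace.comap (ξ j) inferInstance] E) (n : ℕ) :
    P (E ∩ {ω | n ∈ renewalSet (fun j => ξ (i + j)) ω}) =
      P E * P {ω | n ∈ renewalSet ξ ω} := by
  have hind := indep_iSup_of_disjoint (fun j => (h.measurable j).comap_le) h.indep.iIndep
    (S := Set.Iio i) (T := Set.Ici i)
    (Set.disjoint_left.2 fun j hj hj' => absurd (Set.mem_Ici.1 hj') (not_le.2 hj))
  rw [← h.measure_shift i n]
  refine (Indep_iff _ _ _).1 hind _ _ hE ?_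
  refine @measurableSet_mem_renewalSet Ω
    (⨆ j ∈ Set.Ici i, MeasurableSpace.comap (ξ j) inferInstance) _ (fun j => ?_) n
  exact measurable_iff_comap_le.2
    (le_iSup₂ (f := fun j (_ : j ∈ Set.Ici i) => MeasurableSpace.comap (ξ j) inferInstance)
      (i + j) (Set.mem_Ici.2 (Nat.le_add_right i j)))

omit h [MeasurableSpace Ω] in
theorem measurable_iSup_comap {i j : ℕ} (hj : j < i) :
    Measurable[⨆ j ∈ Set.Iio i, MeasurableSpace.comap (ξ j) inferInstance] (ξ j) :=
  measurable_iff_comap_le.2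
    (le_iSup₂ (f := fun j (_ : j ∈ Set.Iio i) => MeasurableSpace.comap (ξ j) inferInstance)
      j (Set.mem_Iio.2 hj))

/-- The regeneration property at a point `k` of the renewal set: given the past up to `k`, the
future is a copy of the process. -/
theorem measure_traceEvent_inter {k n : ℕ} (hkn : k ≤ n) {S : Finset ℕ} (hkS : k ∈ S) :
    P (traceEvent (renewalSet ξ) k S ∩ {ω | n ∈ renewalSet ξ ω}) =
      P (traceEvent (renewalSet ξ) k S) * P {ω | n - k ∈ renewalSet ξ ω} := by
  set G := {ω | ∀ i, 1 ≤ ξ i ω} with hG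
  -- The index of the renewal at `k` is `i`, and the trace is read off the first `i` steps.
  set E : ℕ → Set Ω := fun i => {ω | renewalTime ξ i ω = k} ∩
    {ω | ∀ m ≤ k, m ∈ S ↔ ∃ l ≤ i, renewalTime ξ l ω = m} with hEdef
  have hEpast : ∀ i, MeasurableSet[⨆ j ∈ Set.Iio i, MeasurableSpace.comap (ξ j) inferInstance]
      (E i) := by
    intro i
    let m0 : MeasurableSpace Ω := ⨆ j ∈ Set.Iio i, MeasurableSpace.comap (ξ j) inferInstance
    refine MeasurableSet.inter
      (measurableSet_renewalTime_eq (fun j hj => measurable_iSup_comap hj) k) ?_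
    refine measurableSet_traceEvent (A := fun ω => {m | ∃ l ≤ i, renewalTime ξ l ω = m})
      (fun m => ?_) k S
    have : {ω | m ∈ {m : ℕ | ∃ l ≤ i, renewalTime ξ l ω = m}} =
        ⋃ l, ⋃ (_ : l ≤ i), {ω | renewalTime ξ l ω = m} := by ext ω; simp
    rw [this]
    exact MeasurableSet.iUnion fun l => MeasurableSet.iUnion fun hl =>
      measurableSet_renewalTime_eq (fun j hj => measurable_iSup_comap (hj.trans_le hl)) m
  have hle : ∀ i, (⨆ j ∈ Set.Iio i, MeasurableSpace.comap (ξ j) inferInstance) ≤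
      (inferInstance : MeasurableSpace Ω) :=
    fun i => iSup₂_le fun j _ => (h.measurable j).comap_le
  have hEm : ∀ i, MeasurableSet (E i) := fun i => hle i _ (hEpast i)
  have hGm : MeasurableSet G := h.measurableSet_pos
  have hdisj : ∀ F : ℕ → Set Ω, Pairwise fun i j => Disjoint (E i ∩ F i ∩ G) (E j ∩ F j ∩ G) := by
    intro F i j hij
    rw [Set.disjoint_left]
    rintro ω ⟨⟨⟨hi, -⟩, -⟩, hω⟩ ⟨⟨⟨hj, -⟩, -⟩, -⟩
    rcases lt_or_gt_of_ne hij with hlt | hlt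
    · exact absurd (renewalTime_lt hω hlt hi) (by rw [show renewalTime ξ j ω = k from hj]; simp)
    · exact absurd (renewalTime_lt hω hlt hj) (by rw [show renewalTime ξ i ω = k from hi]; simp)
  have hmem : ∀ ω ∈ G, ω ∈ traceEvent (renewalSet ξ) k S ↔ ∃ i, ω ∈ E i := by
    intro ω hω
    constructor
    · intro ht
      obtain ⟨i, hi⟩ := (ht k le_rfl).1 hkS
      exact ⟨i, hi, fun m hm => (ht m hm).trans (mem_renewalSet_iff_exists_le hω hi hm)⟩
    · rintro ⟨i, hi, hS⟩
      exact fun m hm => (hS m hm).trans (mem_renewalSet_iff_exists_le hω hi hm).symm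
  have hU1 : traceEvent (renewalSet ξ) k S ∩ G = ⋃ i, (E i ∩ Set.univ ∩ G) := by
    ext ω
    simp only [Set.mem_inter_iff, Set.mem_iUnion, Set.mem_univ, and_true]
    constructor
    · rintro ⟨h1, h2⟩
      obtain ⟨i, hi⟩ := (hmem ω h2).1 h1
      exact ⟨i, hi, h2⟩
    · rintro ⟨i, h1, h2⟩
      exact ⟨(hmem ω h2).2 ⟨i, h1⟩, h2⟩
  have hU2 : traceEvent (renewalSet ξ) k S ∩ {ω | n ∈ renewalSet ξ ω} ∩ G =
      ⋃ i, (E i ∩ {ω | n - k ∈ renewalSet (fun j => ξ (i + j)) ω} ∩ G) := by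
    ext ω
    simp only [Set.mem_inter_iff, Set.mem_iUnion]
    constructor
    · rintro ⟨⟨h1, h3⟩, h2⟩
      obtain ⟨i, hi⟩ := (hmem ω h2).1 h1
      exact ⟨i, ⟨hi, (mem_renewalSet_iff_of_renewalTime_eq h2 hi.1 hkn).1 h3⟩, h2⟩
    · rintro ⟨i, ⟨h1, h3⟩, h2⟩
      exact ⟨⟨(hmem ω h2).2 ⟨i, h1⟩, (mem_renewalSet_iff_of_renewalTime_eq h2 h1.1 hkn).2 h3⟩, h2⟩
  rw [← measure_inter_conull h.measure_compl_pos, ← hG, hU2,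
    ← measure_inter_conull (s := traceEvent (renewalSet ξ) k S) h.measure_compl_pos, ← hG, hU1,
    measure_iUnion (hdisj _) (fun i => ((hEm i).inter (measurableSet_mem_renewalSet
      (fun j => h.measurable (i + j)) _)).inter hGm),
    measure_iUnion (hdisj _) (fun i => ((hEm i).inter MeasurableSet.univ).inter hGm),
    ← ENNReal.tsum_mul_right]
  refine tsum_congr fun i => ?_
  rw [measure_inter_conull h.measure_compl_pos, measure_inter_conull h.measure_compl_pos,
    Set.inter_univ]
  exact h.measure_inter_shift (hEpast i) (n - k)

end IsInterarrival

end Renewal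

theorem RenewalPair.of_mass_eq {p a : ℕ → ℝ} (hp : ∀ n, 0 ≤ p n) (hp0 : p 0 = 0)
    (hp1 : ∀ n, psum p n ≤ 1) (ha0 : a 0 = 1) (ha : ∀ n, 1 ≤ n → a n = conv p a n) :
    RenewalPair p a where
  nonneg := hp
  zero := hp0
  psum_le := hp1
  mul_eq := by
    ext n
    rw [mul_sub, mul_one, mul_comm, ← mk_conv, map_sub, PowerSeries.coeff_one]
    simp only [PowerSeries.coeff_mk]
    split_ifs with hn
    · subst hn; simp [ha0, conv_eq_sum_range, hp0]
    · rw [← ha n (by omega), sub_self]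

section Renewal

variable {Ω : Type*} [MeasurableSpace Ω] {P : Measure Ω} [IsProbabilityMeasure P]

theorem psum_measureReal_le {g : Ω → ℕ∞} (hg : ∀ n : ℕ, MeasurableSet {ω | g ω = n}) (n : ℕ) :
    psum (fun n => P.real {ω | g ω = (n : ℕ∞)}) n ≤ 1 - P.real {ω | g ω = ⊤} := by
  have hm : MeasurableSet (⋃ k ∈ Finset.range (n + 1), {ω | g ω = (k : ℕ∞)}) :=
    Finset.measurableSet_biUnion _ fun k _ => hg k
  have h1 : psum (fun n => P.real {ω | g ω = (n : ℕ∞)}) n =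
      P.real (⋃ k ∈ Finset.range (n + 1), {ω | g ω = (k : ℕ∞)}) := by
    rw [measureReal_biUnion_finset (fun i _ j _ hij => Set.disjoint_left.2 fun ω hi hj => ?_)
      (fun k _ => hg k)]
    · rfl
    · exact hij (by exact_mod_cast (show g ω = i from hi).symm.trans hj)
  have h2 : {ω | g ω = ⊤} ⊆ (⋃ k ∈ Finset.range (n + 1), {ω | g ω = (k : ℕ∞)})ᶜ := by
    intro ω hω hmem
    simp only [Set.mem_iUnion] at hmem
    obtain ⟨k, -, hk⟩ := hmem
    exact ENat.natCast_ne_top k ((show g ω = k from hk).symm.trans hω)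
  have h3 := measureReal_mono (μ := P) h2
  rw [probReal_compl_eq_one_sub hm] at h3
  linarith

namespace IsInterarrival

variable {ξ : ℕ → Ω → ℕ∞} (h : IsInterarrival ξ P)
include h

theorem renewalPair : RenewalPair (fun n : ℕ => P.real {ω | renewalTime ξ 1 ω = (n : ℕ∞)})
    (fun n => P.real {ω | n ∈ renewalSet ξ ω}) := by
  have hone : ∀ ω, renewalTime ξ 1 ω = ξ 0 ω := fun ω => by simp [renewalTime]
  have hm : ∀ n : ℕ, MeasurableSet {ω | renewalTime ξ 1 ω = n} :=
    measurableSet_renewalTime_eq fun i _ => h.measurable i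
  refine RenewalPair.of_mass_eq (fun _ => measureReal_nonneg) ?_
    (fun n => (psum_measureReal_le hm n).trans (sub_le_self _ measureReal_nonneg)) ?_
    fun n hn => ?_
  · rw [measureReal_def, ← measure_inter_conull h.measure_compl_pos]
    have : {ω | renewalTime ξ 1 ω = ((0 : ℕ) : ℕ∞)} ∩ {ω | ∀ i, 1 ≤ ξ i ω} = ∅ := by
      rw [Set.eq_empty_iff_forall_notMem]
      rintro ω ⟨h1, h2⟩
      have h3 := h2 0
      rw [← hone, show renewalTime ξ 1 ω = ((0 : ℕ) : ℕ∞) from h1] at h3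
      simp at h3
    rw [this]
    simp
  · simp [zero_mem_renewalSet]
  · have hpast : ∀ k : ℕ, MeasurableSet[⨆ j ∈ Set.Iio 1,
        MeasurableSpace.comap (ξ j) inferInstance] {ω | renewalTime ξ 1 ω = k} := fun k =>
      @measurableSet_renewalTime_eq Ω (⨆ j ∈ Set.Iio 1,
        MeasurableSpace.comap (ξ j) inferInstance) ξ 1 (fun j hj => measurable_iSup_comap hj) k
    have hU : {ω | n ∈ renewalSet ξ ω} ∩ {ω | ∀ i, 1 ≤ ξ i ω} =
        ⋃ k ∈ Finset.range (n + 1), ({ω | renewalTime ξ 1 ω = (k : ℕ∞)} ∩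
          {ω | n - k ∈ renewalSet (fun j => ξ (1 + j)) ω} ∩ {ω | ∀ i, 1 ≤ ξ i ω}) := by
      ext ω
      simp only [Set.mem_inter_iff, Set.mem_iUnion, Finset.mem_range, exists_prop]
      constructor
      · rintro ⟨⟨l, hl⟩, hω⟩
        have hl1 : 1 ≤ l := by
          by_contra! hlt
          obtain rfl : l = 0 := by omega
          have : (0 : ℕ∞) = n := by simpa [renewalTime] using hl
          have : 0 = n := by exact_mod_cast this
          omega
        have hle : renewalTime ξ 1 ω ≤ n := hl ▸ renewalTime_mono ξ ω hl1
        obtain ⟨k, hk⟩ := ENat.ne_top_iff_exists.1 (ne_top_of_le_ne_top (ENat.natCast_ne_top n) hle)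
        have hkn : k ≤ n := by rw [← hk] at hle; exact_mod_cast hle
        exact ⟨k, by omega, ⟨hk.symm,
          (mem_renewalSet_iff_of_renewalTime_eq hω hk.symm hkn).1 ⟨l, hl⟩⟩, hω⟩
      · rintro ⟨k, hk, ⟨h1, h2⟩, hω⟩
        exact ⟨(mem_renewalSet_iff_of_renewalTime_eq hω h1 (by omega)).2 h2, hω⟩
    rw [measureReal_def, ← measure_inter_conull h.measure_compl_pos, ← measureReal_def, hU,
      measureReal_biUnion_finset, conv_eq_sum_range]
    · refine Finset.sum_congr rfl fun k _ => ?_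
      rw [measureReal_def, measure_inter_conull h.measure_compl_pos,
        h.measure_inter_shift (hpast k), ENNReal.toReal_mul]
      rfl
    · intro i _ j _ hij
      refine Set.disjoint_left.2 fun ω hi hj => hij ?_
      exact_mod_cast (show renewalTime ξ 1 ω = i from hi.1.1).symm.trans hj.1.1
    · exact fun k _ => ((hm k).inter (measurableSet_mem_renewalSet
        (fun j => h.measurable (1 + j)) _)).inter h.measurableSet_pos

end IsInterarrival

/-! ### The intersection of two renewal sets -/

section Intersection

variable {ξ η : ℕ → Ω → ℕ∞} (hξ : IsInterarrival ξ P) (hη : IsInterarrival η P)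
  (hindep : IndepFun (fun ω i => ξ i ω) (fun ω i => η i ω) P)
include hξ hη

omit [IsProbabilityMeasure P] in
theorem measurableSet_mem_inter (n : ℕ) :
    MeasurableSet {ω | n ∈ renewalSet ξ ω ∩ renewalSet η ω} :=
  (measurableSet_mem_renewalSet hξ.measurable n).inter
    (measurableSet_mem_renewalSet hη.measurable n)

omit [IsProbabilityMeasure P] in
theorem measurableSet_firstPoint_eq (k : ℕ) : MeasurableSet
    {ω | firstPoint (fun ω => renewalSet ξ ω ∩ renewalSet η ω) ω = (k : ℕ∞)} := by
  have : {ω | firstPoint (fun ω => renewalSet ξ ω ∩ renewalSet η ω) ω = (k : ℕ∞)} =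
      {ω | k ∈ renewalSet ξ ω ∩ renewalSet η ω} ∩ ({_ω | 0 < k} ∩
        ⋂ j, ⋂ (_ : 0 < j), ⋂ (_ : j < k), {ω | j ∈ renewalSet ξ ω ∩ renewalSet η ω}ᶜ) := by
    ext ω
    simp only [Set.mem_inter_iff, Set.mem_iInter]
    exact firstPoint_eq_coe_iff
  rw [this]
  exact (measurableSet_mem_inter hξ hη k).inter ((MeasurableSet.const _).inter
    (MeasurableSet.iInter fun j => MeasurableSet.iInter fun _ => MeasurableSet.iInter fun _ =>
      (measurableSet_mem_inter hξ hη j).compl))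

include hindep

omit hξ hη [IsProbabilityMeasure P] in
/-- Events on the two renewal sets are independent. -/
theorem measureReal_inter_eq_mul {s t : Set (ℕ → ℕ∞)} (hs : MeasurableSet s)
    (ht : MeasurableSet t) : P.real ({ω | (fun i => ξ i ω) ∈ s} ∩ {ω | (fun i => η i ω) ∈ t}) =
      P.real {ω | (fun i => ξ i ω) ∈ s} * P.real {ω | (fun i => η i ω) ∈ t} := by
  rw [measureReal_def, measureReal_def, measureReal_def, ← ENNReal.toReal_mul]
  exact congrArg _ (hindep.measure_inter_preimage_eq_mul s t hs ht)

omit hξ hη [IsProbabilityMeasure P] in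
theorem measureReal_mem_inter (n : ℕ) : P.real {ω | n ∈ renewalSet ξ ω ∩ renewalSet η ω} =
    P.real {ω | n ∈ renewalSet ξ ω} * P.real {ω | n ∈ renewalSet η ω} := by
  have hm : MeasurableSet {x : ℕ → ℕ∞ | n ∈ renewalSet (fun i (x : ℕ → ℕ∞) => x i) x} :=
    measurableSet_mem_renewalSet (fun i => measurable_pi_apply i) n
  exact measureReal_inter_eq_mul hindep hm hm

/-- The regeneration property of the intersection at its first positive point, by summation over
the traces of the two sets up to that point. -/
theorem measureReal_firstPoint_inter {k n : ℕ} (hkn : k ≤ n) :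
    P.real ({ω | firstPoint (fun ω => renewalSet ξ ω ∩ renewalSet η ω) ω = (k : ℕ∞)} ∩
        {ω | n ∈ renewalSet ξ ω ∩ renewalSet η ω}) =
      P.real {ω | firstPoint (fun ω => renewalSet ξ ω ∩ renewalSet η ω) ω = (k : ℕ∞)} *
        P.real {ω | n - k ∈ renewalSet ξ ω ∩ renewalSet η ω} := by
  classical
  set I : Finset (Finset ℕ × Finset ℕ) :=
    ((Finset.range (k + 1)).powerset ×ˢ (Finset.range (k + 1)).powerset).filter fun st =>
      (k ∈ st.1 ∧ k ∈ st.2) ∧ 0 < k ∧ ∀ j, 0 < j → j < k → ¬ (j ∈ st.1 ∧ j ∈ st.2) with hI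
  set T : Finset ℕ × Finset ℕ → Set Ω := fun st =>
    traceEvent (renewalSet ξ) k st.1 ∩ traceEvent (renewalSet η) k st.2 with hT
  have hTm : ∀ st, MeasurableSet (T st) := fun st =>
    (measurableSet_traceEvent (measurableSet_mem_renewalSet hξ.measurable) k _).inter
      (measurableSet_traceEvent (measurableSet_mem_renewalSet hη.measurable) k _)
  have huniq : ∀ st ∈ I, ∀ st' ∈ I, ∀ ω, ω ∈ T st → ω ∈ T st' → st = st' := by
    intro st hst st' hst' ω h1 h2
    simp only [hI, Finset.mem_filter, Finset.mem_product, Finset.mem_powerset] at hst hst'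
    have key : ∀ {A : Ω → Set ℕ} {S S' : Finset ℕ}, S ⊆ Finset.range (k + 1) →
        S' ⊆ Finset.range (k + 1) → ω ∈ traceEvent A k S → ω ∈ traceEvent A k S' → S = S' := by
      intro A S S' hS hS' h h'
      ext m
      by_cases hm : m ≤ k
      · rw [h m hm, h' m hm]
      · exact iff_of_false (fun hm' => hm (by have := Finset.mem_range.1 (hS hm'); omega))
          (fun hm' => hm (by have := Finset.mem_range.1 (hS' hm'); omega))
    exact Prod.ext (key hst.1.1 hst'.1.1 h1.1 h2.1) (key hst.1.2 hst'.1.2 h1.2 h2.2)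
  have hU : {ω | firstPoint (fun ω => renewalSet ξ ω ∩ renewalSet η ω) ω = (k : ℕ∞)} =
      ⋃ st ∈ I, T st := by
    ext ω
    simp only [Set.mem_iUnion, exists_prop]
    refine firstPoint_eq_coe_iff.trans ⟨?_, ?_⟩
    · rintro ⟨hk, hk0, hj⟩
      have htr : ∀ A : Ω → Set ℕ,
          ω ∈ traceEvent A k ((Finset.range (k + 1)).filter (· ∈ A ω)) := fun A m hm => by
        rw [Finset.mem_filter, Finset.mem_range]
        exact ⟨fun h => h.2, fun h => ⟨by omega, h⟩⟩
      refine ⟨((Finset.range (k + 1)).filter (· ∈ renewalSet ξ ω),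
        (Finset.range (k + 1)).filter (· ∈ renewalSet η ω)), ?_, htr _, htr _⟩
      simp only [hI, Finset.mem_filter, Finset.mem_product, Finset.mem_powerset,
        Finset.filter_subset, true_and, Finset.mem_range]
      exact ⟨⟨⟨by omega, hk.1⟩, by omega, hk.2⟩, hk0,
        fun j hj0 hjk hcon => hj j hj0 hjk ⟨hcon.1.2, hcon.2.2⟩⟩
    · rintro ⟨st, hst, h1, h2⟩
      simp only [hI, Finset.mem_filter] at hst
      obtain ⟨-, ⟨hk1, hk2⟩, hk0, hj⟩ := hst
      refine ⟨⟨(h1 k le_rfl).1 hk1, (h2 k le_rfl).1 hk2⟩, hk0, fun j hj0 hjk hcon => ?_⟩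
      exact hj j hj0 hjk ⟨(h1 j hjk.le).2 hcon.1, (h2 j hjk.le).2 hcon.2⟩
  have htrm : ∀ S, MeasurableSet (traceEvent (renewalSet fun i (x : ℕ → ℕ∞) => x i) k S) :=
    fun S => measurableSet_traceEvent
      (measurableSet_mem_renewalSet fun i => measurable_pi_apply i) k S
  have hnm : MeasurableSet {x : ℕ → ℕ∞ | n ∈ renewalSet (fun i (x : ℕ → ℕ∞) => x i) x} :=
    measurableSet_mem_renewalSet (fun i => measurable_pi_apply i) n
  have hterm : ∀ st ∈ I, P.real (T st ∩ {ω | n ∈ renewalSet ξ ω ∩ renewalSet η ω}) =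
      P.real (T st) * P.real {ω | n - k ∈ renewalSet ξ ω ∩ renewalSet η ω} := by
    intro st hst
    simp only [hI, Finset.mem_filter] at hst
    obtain ⟨-, ⟨hk1, hk2⟩, -⟩ := hst
    have e1 : P.real (T st ∩ {ω | n ∈ renewalSet ξ ω ∩ renewalSet η ω}) =
        P.real (traceEvent (renewalSet ξ) k st.1 ∩ {ω | n ∈ renewalSet ξ ω}) *
          P.real (traceEvent (renewalSet η) k st.2 ∩ {ω | n ∈ renewalSet η ω}) := by
      have := measureReal_inter_eq_mul hindep ((htrm st.1).inter hnm) ((htrm st.2).inter hnm)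
      refine Eq.trans (congrArg _ ?_) this
      exact Set.inter_inter_inter_comm _ _ _ _
    have e2 : P.real (T st) = P.real (traceEvent (renewalSet ξ) k st.1) *
        P.real (traceEvent (renewalSet η) k st.2) :=
      measureReal_inter_eq_mul hindep (htrm st.1) (htrm st.2)
    rw [e1, e2, measureReal_mem_inter hindep]
    simp only [measureReal_def]
    rw [hξ.measure_traceEvent_inter hkn hk1, hη.measure_traceEvent_inter hkn hk2,
      ENNReal.toReal_mul, ENNReal.toReal_mul]
    ring
  rw [hU, Set.iUnion₂_inter, measureReal_biUnion_finset, measureReal_biUnion_finset,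
    Finset.sum_mul]
  · exact Finset.sum_congr rfl hterm
  · exact fun st hst st' hst' hne => Set.disjoint_left.2 fun ω h1 h2 =>
      hne (huniq st hst st' hst' ω h1 h2)
  · exact fun st _ => hTm st
  · exact fun st hst st' hst' hne => Set.disjoint_left.2 fun ω h1 h2 =>
      hne (huniq st hst st' hst' ω h1.1 h2.1)
  · exact fun st _ => (hTm st).inter (measurableSet_mem_inter hξ hη n)

/-- The intersection of two independent renewal sets is a renewal set. -/
theorem renewalPair_inter : RenewalPair
    (fun n : ℕ => P.real
      {ω | firstPoint (fun ω => renewalSet ξ ω ∩ renewalSet η ω) ω = (n : ℕ∞)})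
    (fun n => P.real {ω | n ∈ renewalSet ξ ω ∩ renewalSet η ω}) := by
  have hm := measurableSet_firstPoint_eq hξ hη
  refine RenewalPair.of_mass_eq (fun _ => measureReal_nonneg) ?_
    (fun n => (psum_measureReal_le hm n).trans (sub_le_self _ measureReal_nonneg)) ?_
    fun n hn => ?_
  · have : {ω | firstPoint (fun ω => renewalSet ξ ω ∩ renewalSet η ω) ω = ((0 : ℕ) : ℕ∞)} = ∅ :=
      Set.eq_empty_iff_forall_notMem.2 fun ω hω =>
        lt_irrefl 0 (firstPoint_eq_coe_iff.1 (show _ = _ from hω)).2.1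
    rw [this]
    simp
  · simp [zero_mem_renewalSet]
  · have hU : {ω | n ∈ renewalSet ξ ω ∩ renewalSet η ω} = ⋃ k ∈ Finset.range (n + 1),
        ({ω | firstPoint (fun ω => renewalSet ξ ω ∩ renewalSet η ω) ω = (k : ℕ∞)} ∩
          {ω | n ∈ renewalSet ξ ω ∩ renewalSet η ω}) := by
      rw [← Set.iUnion₂_inter, eq_comm, Set.inter_eq_right]
      intro ω hω
      have hle := firstPoint_le (A := fun ω => renewalSet ξ ω ∩ renewalSet η ω)
        (show n ∈ renewalSet ξ ω ∩ renewalSet η ω from hω) (by omega)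
      obtain ⟨k, hk⟩ := ENat.ne_top_iff_exists.1 (ne_top_of_le_ne_top (ENat.natCast_ne_top n) hle)
      rw [← hk] at hle
      have hkn : k ≤ n := by exact_mod_cast hle
      exact Set.mem_iUnion₂.2 ⟨k, Finset.mem_range.2 (by omega), hk.symm⟩
    rw [hU, measureReal_biUnion_finset, conv_eq_sum_range]
    · exact Finset.sum_congr rfl fun k hk => measureReal_firstPoint_inter hξ hη hindep
        (by have := Finset.mem_range.1 hk; omega)
    · intro i _ j _ hij
      refine Set.disjoint_left.2 fun ω hi hj => hij ?_
      exact_mod_cast (show firstPoint _ ω = i from hi.1).symm.trans hj.1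
    · exact fun k _ => (hm k).inter (measurableSet_mem_inter hξ hη n)

end Intersection

omit [IsProbabilityMeasure P] in
theorem expectedCard_eq_tsum {A : Ω → Set ℕ} (hA : ∀ n, MeasurableSet {ω | n ∈ A ω}) :
    expectedCard A P = ∑' n, P {ω | n ∈ A ω} := by
  have h1 : ∀ ω, ((A ω).encard : ℝ≥0∞) = ∑' n, {ω | n ∈ A ω}.indicator 1 ω := fun ω => by
    rw [← ENNReal.tsum_set_one, tsum_subtype (A ω) fun _ => (1 : ℝ≥0∞)]
    rfl
  rw [expectedCard, lintegral_congr h1,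
    lintegral_tsum fun n => (measurable_one.indicator (hA n)).aemeasurable]
  exact tsum_congr fun n => lintegral_indicator_one (hA n)

end Renewal

theorem mainTheorem5 {Ω : Type*} [MeasurableSpace Ω] (P : Measure Ω) [IsProbabilityMeasure P]
    (ξ η : ℕ → Ω → ℕ∞) (hξ : IsInterarrival ξ P) (hη : IsInterarrival η P)
    (hindep : IndepFun (fun ω i => ξ i ω) (fun ω i => η i ω) P)
    (α α' : ℝ) (hα : 0 ≤ α) (hα' : 0 ≤ α')
    (φ φ' : ℝ → ℝ) (hφ : SlowlyVarying φ) (hφ' : SlowlyVarying φ')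
    (hτ : ∀ n : ℕ, 1 ≤ n →
      P.real {ω | renewalTime ξ 1 ω = (n : ℕ∞)} = φ n * (n : ℝ) ^ (-(1 + α)))
    (hσ : ∀ n : ℕ, 1 ≤ n →
      P.real {ω | renewalTime η 1 ω = (n : ℕ∞)} = φ' n * (n : ℝ) ^ (-(1 + α')))
    (htrans : Transient (fun ω => renewalSet ξ ω ∩ renewalSet η ω) P) :
    expectedCard (fun ω => renewalSet ξ ω ∩ renewalSet η ω) P < ⊤ ∧
    (fun n : ℕ =>
        P.real {ω | firstPoint (fun ω => renewalSet ξ ω ∩ renewalSet η ω) ω = (n : ℕ∞)})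
      ~[atTop]
    (fun n : ℕ =>
        1 / (expectedCard (fun ω => renewalSet ξ ω ∩ renewalSet η ω) P).toReal ^ 2 *
          P.real {ω | n ∈ renewalSet ξ ω} * P.real {ω | n ∈ renewalSet η ω}) := by
  have hpair := renewalPair_inter hξ hη hindep
  have hρ : 0 < P.real {ω | firstPoint (fun ω => renewalSet ξ ω ∩ renewalSet η ω) ω = ⊤} :=
    ENNReal.toReal_pos htrans.ne' (measure_ne_top _ _)
  have hsum := hpair.summable_mass hρ fun n => by
    have := psum_measureReal_le (P := P) (measurableSet_firstPoint_eq hξ hη) n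
    rw [tail]
    linarith
  have hE : expectedCard (fun ω => renewalSet ξ ω ∩ renewalSet η ω) P =
      ENNReal.ofReal (∑' n, P.real {ω | n ∈ renewalSet ξ ω ∩ renewalSet η ω}) := by
    rw [expectedCard_eq_tsum (measurableSet_mem_inter hξ hη),
      ENNReal.ofReal_tsum_of_nonneg (fun _ => measureReal_nonneg) hsum]
    exact tsum_congr fun n => (ENNReal.ofReal_toReal (measure_ne_top _ _)).symm
  obtain ⟨hd, hr⟩ := hξ.renewalPair.doublingSeq_and_tendsto_ratio hα (hφ.regVarSeq hτ)
  obtain ⟨hd', hr'⟩ := hη.renewalPair.doublingSeq_and_tendsto_ratio hα' (hφ'.regVarSeq hσ)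
  have hmul := fun n => measureReal_mem_inter hindep n
  have hdu : DoublingSeq fun n => P.real {ω | n ∈ renewalSet ξ ω ∩ renewalSet η ω} := by
    simp only [hmul]
    exact hd.mul hd' (fun _ => measureReal_nonneg) fun _ => measureReal_nonneg
  have hru : Tendsto (fun n => P.real {ω | n + 1 ∈ renewalSet ξ ω ∩ renewalSet η ω} /
      P.real {ω | n ∈ renewalSet ξ ω ∩ renewalSet η ω}) atTop (𝓝 1) := by
    have := hr.mul hr'
    rw [one_mul] at this
    refine this.congr fun n => ?_
    rw [hmul, hmul, div_mul_div_comm]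
  have hlim := hpair.tendsto_law_div_mass hsum hdu hru
  refine ⟨hE ▸ ENNReal.ofReal_lt_top, ?_⟩
  rw [hE, ENNReal.toReal_ofReal (tsum_nonneg fun _ => measureReal_nonneg)]
  set U := ∑' n, P.real {ω | n ∈ renewalSet ξ ω ∩ renewalSet η ω}
  have hU : U ≠ 0 := left_ne_zero_of_mul_eq_one (hpair.tsum_mass_mul hsum)
  obtain ⟨C, N, hN⟩ := hdu
  have hpos : ∀ᶠ n in atTop, 1 / U ^ 2 * P.real {ω | n ∈ renewalSet ξ ω} *
      P.real {ω | n ∈ renewalSet η ω} ≠ 0 := by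
    filter_upwards [eventually_ge_atTop N] with n hn
    have : P.real {ω | n ∈ renewalSet ξ ω ∩ renewalSet η ω} ≠ 0 := (hN n hn).1.ne'
    rw [hmul] at this
    rw [mul_assoc]
    exact mul_ne_zero (by positivity) this
  rw [isEquivalent_iff_tendsto_one hpos]
  have := hlim.const_mul (U ^ 2)
  rw [mul_one_div_cancel (pow_ne_zero 2 hU)] at this
  refine this.congr fun n => ?_
  simp only [Pi.div_apply]
  rw [hmul]
  simp only [div_eq_mul_inv, mul_inv, inv_inv, one_mul]
  ring
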